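/- **Conventions.** A model category is a bicomplete category $\mathsf M$ with classes $\mathcal F,\mathcal C,\mathcal W$ such that $\mathcal W$ contains the identities and satisfies 2-out-of-3 and $(\mathcal C,\mathcal F\cap\mathcal W)$, $(\mathcal C\cap\mathcal W,\mathcal F)$ are weak factorization systems. A weak factorization system $(\mathcal L,\mathcal R)$ is *fibrantly generated* by a class $\mathcal X$ of morphisms if $\mathcal L$ is exactly the class of morphisms with the left lifting property against every element of $\mathcal X$. The model category $\mathsf M$ is *fibrantly generated* by $(\mathcal X,\mathcal Z)$ if $(\mathcal C\cap\mathcal W,\mathcal F)$ is fibrantly generated by $\mathcal X$ and $(\mathcal C,\mathcal F\cap\mathcal W)$ is fibrantly generated by $\mathcal Z$. A Reedy category is a small category $\mathsf R$ with a degree function $\deg:\operatorname{Ob}\mathsf R\to\mathbb N$ and wide subcategories $\mathsf R^+,\mathsf R^-$ such that non-identity morphisms of $\mathsf R^+$ (resp. $\mathsf R^-$) strictly raise (resp. lower) degree and every morphism factors uniquely as a morphism of $\mathsf R^-$ followed by a morphism of $\mathsf R^+$. Its opposite $\mathsf R^{op}$ is a Reedy category with the same degrees, $(\mathsf R^{op})^+=(\mathsf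 R^-)^{op}$ and $(\mathsf R^{op})^-=(\mathsf R^+)^{op}$. For $\Phi:\mathsf R\to\mathsf M$ and $r\in\mathsf R$, the latching object $L_r\Phi$ is the colimit of $\Phi(s)$ over the category of maps $s\to r$ in $\mathsf R^+$ with $\deg s<\deg r$ (and maps in $\mathsf R^+$ over $r$), and the matching object $M_r\Phi$ is the limit of $\Phi(s)$ over the category of maps $r\to s$ in $\mathsf R^-$ with $\deg s<\deg r$ (and maps in $\mathsf R^-$ under $r$). The Reedy model structure on $\mathsf M^{\mathsf R}$ has as weak equivalences the objectwise weak equivalences, as cofibrations the $\tau:\Phi\to\Psi$ for which every $\Phi(r)\sqcup_{L_r\Phi}L_r\Psi\to\Psi(r)$ is a cofibration, and as fibrations those for which every $\Phi(r)\to M_r\Phi\times_{M_r\Psi}\Psi(r)$ is a fibration. For $A,E\in\mathsf M$, $F:\mathsf R\to\mathsf{Set}$ and $G:\mathsf R^{op}\to\mathsf{Set}$ write $(A\otimes F)(s)=\coprod_{F(s)}A$ and $(E\pitchfork G)(s)=\prod_{G(s)}E$. Let $\partial\mathsf R(r,-)\subseteq\mathsf R(r,-)$ and $\partial\mathsf R(-,r)\subseteq\mathsf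 R(-,r)$ consist of the maps that factor through an object of degree less than $\deg r$. For a class $\mathcal I$ (resp. $\mathcal X$) of morphisms, $\mathcal I\,\widehat\otimes\,\mathsf R$ is the class of the pushout-products $$A\otimes\mathsf R(r,-)\sqcup_{A\otimes\partial\mathsf R(r,-)}B\otimes\partial\mathsf R(r,-)\to B\otimes\mathsf R(r,-),\qquad (i:A\to B)\in\mathcal I,\ r\in\mathsf R,$$ and $\mathcal X\,\widehat\pitchfork\,\mathsf R$ is the class of the pullback-cotensors $$E\pitchfork\mathsf R(-,r)\to E\pitchfork\partial\mathsf R(-,r)\times_{B\pitchfork\partial\mathsf R(-,r)}B\pitchfork\mathsf R(-,r),\qquad (p:E\to B)\in\mathcal X,\ r\in\mathsf R.$$ **Theorem.** Let $\mathsf M$ be a model category fibrantly generated by sets (or, more generally, classes) of morphisms $(\mathcal X,\mathcal Z)$, and let $\mathsf R$ be a Reedy category. Then $\mathsf M^{\mathsf R}$ is a model category with the Reedy model structure, and it is fibrantly generated by $$\big((\mathcal X^{op}\,\widehat\otimes\,\mathsf R^{op})^{op},\ (\mathcal Z^{op}\,\widehat\otimes\,\mathsf R^{op})^{op}\big).$$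 Moreover $\mathcal X\,\widehat\pitchfork\,\mathsf R=(\mathcal X^{op}\,\widehat\otimes\,\mathsf R^{op})^{op}$ and $\mathcal Z\,\widehat\pitchfork\,\mathsf R=(\mathcal Z^{op}\,\widehat\otimes\,\mathsf R^{op})^{op}$ up to isomorphism of arrows, so $\mathsf M^{\mathsf R}$ is also fibrantly generated by $(\mathcal X\,\widehat\pitchfork\,\mathsf R,\ \mathcal Z\,\widehat\pitchfork\,\mathsf R)$. -/

import Mathlib

open CategoryTheory CategoryTheory.Limits HomotopicalAlgebra Opposite

universe v u

namespace HomotopicalAlgebra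

/-- A weak factorization system `(L, R)` is fibrantly generated by a class `X` of morphisms
if `L` is exactly the class of morphisms with the left lifting property against `X`
(and hence `R = rlp (llp X)`). -/
structure IsWFSFibrantlyGeneratedBy {E : Type*} [Category* E] (L R X : MorphismProperty E) :
    Prop where
  isWeakFactorizationSystem : L.IsWeakFactorizationSystem R
  eq_llp : L = X.llp

/-- A model category is fibrantly generated by a pair `(X, Z)` of classes of morphisms if the weak
factorization systems (acyclic cofibrations, fibrations) and (cofibrations, acyclic fibrations)
are fibrantly generated by `X` and `Z` respectively. -/
structure IsFibrantlyGeneratedBy (E : Type*) [Category* E] [ModelCategory E]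
    (X Z : MorphismProperty E) : Prop where
  fibrations : IsWFSFibrantlyGeneratedBy (trivialCofibrations E) (fibrations E) X
  trivialFibrations : IsWFSFibrantlyGeneratedBy (cofibrations E) (trivialFibrations E) Z

namespace ReedyStructure

/-! In this section `R` is a small category with a Reedy structure `ρ`, whose degree-lowering
maps are the class `Rm` and whose degree-raising maps are the class `Rp`. -/

section

variable {R : Type v} [SmallCategory R] {Rm Rp : MorphismProperty R}
  [Rm.IsMultiplicative] [Rp.IsMultiplicative] (ρ : ReedyStructure Rm Rp ℕ) (r : R)

/-! ### Latching and matching objects -/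

/-- The category whose objects are the degree-raising maps `s ⟶ r` with `deg s < deg r`, and whose
morphisms are the degree-raising maps over `r`. -/
abbrev LatchingCategory : Type v :=
  ObjectProperty.FullSubcategory (fun f : Rp.Over Rp r ↦ ρ.deg f.left < ρ.deg r)

/-- The category whose objects are the degree-lowering maps `r ⟶ s` with `deg s < deg r`, and whose
morphisms are the degree-lowering maps under `r`. -/
abbrev MatchingCategory : Type v :=
  ObjectProperty.FullSubcategory (fun f : Rm.Under Rm r ↦ ρ.deg f.right < ρ.deg r)

/-- The forgetful functor `(s ⟶ r) ↦ s`. -/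
abbrev latchingForget : ρ.LatchingCategory r ⥤ R :=
  ObjectProperty.ι _ ⋙ MorphismProperty.Over.forget Rp Rp r ⋙ Over.forget r

/-- The forgetful functor `(r ⟶ s) ↦ s`. -/
abbrev matchingForget : ρ.MatchingCategory r ⥤ R :=
  ObjectProperty.ι _ ⋙ MorphismProperty.Under.forget Rm Rm r ⋙ Under.forget r

variable {M : Type u} [Category.{v} M]

/-- The cocone with point `Φ r` given by the maps `Φ f : Φ s ⟶ Φ r`. -/
@[simps]
def latchingCocone (Φ : R ⥤ M) : Cocone (ρ.latchingForget r ⋙ Φ) where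
  pt := Φ.obj r
  ι :=
    { app := fun f ↦ Φ.map f.obj.hom
      naturality := fun f g a ↦ by
        have h : a.hom.left ≫ g.obj.hom = f.obj.hom := MorphismProperty.Over.w a.hom
        change Φ.map a.hom.left ≫ Φ.map g.obj.hom = Φ.map f.obj.hom ≫ 𝟙 _
        rw [← Φ.map_comp, h, Category.comp_id] }

/-- The cone with point `Φ r` given by the maps `Φ f : Φ r ⟶ Φ s`. -/
@[simps]
def matchingCone (Φ : R ⥤ M) : Cone (ρ.matchingForget r ⋙ Φ) where
  pt := Φ.obj r
  π :=
    { app := fun f ↦ Φ.map f.obj.hom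
      naturality := fun f g a ↦ by
        have h : f.obj.hom ≫ a.hom.right = g.obj.hom := MorphismProperty.Under.w a.hom
        change 𝟙 _ ≫ Φ.map g.obj.hom = Φ.map f.obj.hom ≫ Φ.map a.hom.right
        rw [← Φ.map_comp, h, Category.id_comp] }

section

variable [HasColimits M]

/-- The latching object `L_r Φ`. -/
noncomputable def latchingObj (Φ : R ⥤ M) : M :=
  colimit (ρ.latchingForget r ⋙ Φ)

/-- The map `L_r Φ ⟶ L_r Ψ` induced by `τ : Φ ⟶ Ψ`. -/
noncomputable def latchingObjMap {Φ Ψ : R ⥤ M} (τ : Φ ⟶ Ψ) :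
    ρ.latchingObj r Φ ⟶ ρ.latchingObj r Ψ :=
  colimMap (Functor.whiskerLeft (ρ.latchingForget r) τ)

/-- The latching map `L_r Φ ⟶ Φ r`. -/
noncomputable def latchingMap (Φ : R ⥤ M) : ρ.latchingObj r Φ ⟶ Φ.obj r :=
  colimit.desc (ρ.latchingForget r ⋙ Φ) (ρ.latchingCocone r Φ)

lemma latching_comm {Φ Ψ : R ⥤ M} (τ : Φ ⟶ Ψ) :
    ρ.latchingMap r Φ ≫ τ.app r = ρ.latchingObjMap r τ ≫ ρ.latchingMap r Ψ := by
  refine colimit.hom_ext (fun j ↦ ?_)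
  have h₁ := colimit.ι_desc (ρ.latchingCocone r Φ) j
  have h₂ := colimit.ι_desc (ρ.latchingCocone r Ψ) j
  have h₃ := ι_colimMap (Functor.whiskerLeft (ρ.latchingForget r) τ) j
  have h₄ : Φ.map j.obj.hom ≫ τ.app r = τ.app j.obj.left ≫ Ψ.map j.obj.hom := τ.naturality _
  exact (Category.assoc _ _ _).symm.trans <| (congrArg (· ≫ τ.app r) h₁).trans <| h₄.trans <|
    (congrArg (τ.app j.obj.left ≫ ·) h₂).symm.trans <| (Category.assoc _ _ _).symm.trans <|
    (congrArg (· ≫ ρ.latchingMap r Ψ) h₃).symm.trans <| Category.assoc _ _ _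

/-- The relative latching map `Φ r ⊔_{L_r Φ} L_r Ψ ⟶ Ψ r`. -/
noncomputable def relativeLatchingMap {Φ Ψ : R ⥤ M} (τ : Φ ⟶ Ψ) :
    pushout (ρ.latchingMap r Φ) (ρ.latchingObjMap r τ) ⟶ Ψ.obj r :=
  pushout.desc (τ.app r) (ρ.latchingMap r Ψ) (ρ.latching_comm r τ)

end

section

variable [HasLimits M]

/-- The matching object `M_r Φ`. -/
noncomputable def matchingObj (Φ : R ⥤ M) : M :=
  limit (ρ.matchingForget r ⋙ Φ)

/-- The map `M_r Φ ⟶ M_r Ψ` induced by `τ : Φ ⟶ Ψ`. -/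
noncomputable def matchingObjMap {Φ Ψ : R ⥤ M} (τ : Φ ⟶ Ψ) :
    ρ.matchingObj r Φ ⟶ ρ.matchingObj r Ψ :=
  limMap (Functor.whiskerLeft (ρ.matchingForget r) τ)

/-- The matching map `Φ r ⟶ M_r Φ`. -/
noncomputable def matchingMap (Φ : R ⥤ M) : Φ.obj r ⟶ ρ.matchingObj r Φ :=
  limit.lift (ρ.matchingForget r ⋙ Φ) (ρ.matchingCone r Φ)

lemma matching_comm {Φ Ψ : R ⥤ M} (τ : Φ ⟶ Ψ) :
    ρ.matchingMap r Φ ≫ ρ.matchingObjMap r τ = τ.app r ≫ ρ.matchingMap r Ψ := by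
  refine limit.hom_ext (fun j ↦ ?_)
  have h₁ := limit.lift_π (ρ.matchingCone r Φ) j
  have h₂ := limit.lift_π (ρ.matchingCone r Ψ) j
  have h₃ := limMap_π (Functor.whiskerLeft (ρ.matchingForget r) τ) j
  have h₄ : Φ.map j.obj.hom ≫ τ.app j.obj.right = τ.app r ≫ Ψ.map j.obj.hom :=
    (τ.naturality _)
  exact (Category.assoc _ _ _).trans <| (congrArg (ρ.matchingMap r Φ ≫ ·) h₃).trans <|
    (Category.assoc _ _ _).symm.trans <| (congrArg (· ≫ τ.app j.obj.right) h₁).trans <|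
    h₄.trans <| (congrArg (τ.app r ≫ ·) h₂).symm.trans <| (Category.assoc _ _ _).symm

/-- The relative matching map `Φ r ⟶ M_r Φ ×_{M_r Ψ} Ψ r`. -/
noncomputable def relativeMatchingMap {Φ Ψ : R ⥤ M} (τ : Φ ⟶ Ψ) :
    Φ.obj r ⟶ pullback (ρ.matchingObjMap r τ) (ρ.matchingMap r Ψ) :=
  pullback.lift (ρ.matchingMap r Φ) (τ.app r) (ρ.matching_comm r τ)

end

/-- A model structure on `R ⥤ M` is the Reedy model structure if the weak equivalences are
objectwise, the cofibrations are the maps all of whose relative latching maps are cofibrations,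
and the fibrations are the maps all of whose relative matching maps are fibrations. -/
structure IsReedyModelStructure [ModelCategory M] [HasLimits M] [HasColimits M]
    [ModelCategory (R ⥤ M)] : Prop where
  weakEquivalences_iff {Φ Ψ : R ⥤ M} (τ : Φ ⟶ Ψ) :
    weakEquivalences (R ⥤ M) τ ↔ ∀ r : R, weakEquivalences M (τ.app r)
  cofibrations_iff {Φ Ψ : R ⥤ M} (τ : Φ ⟶ Ψ) :
    cofibrations (R ⥤ M) τ ↔ ∀ r : R, cofibrations M (ρ.relativeLatchingMap r τ)
  fibrations_iff {Φ Ψ : R ⥤ M} (τ : Φ ⟶ Ψ) :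
    fibrations (R ⥤ M) τ ↔ ∀ r : R, fibrations M (ρ.relativeMatchingMap r τ)

/-! ### The boundary inclusions -/

/-- `∂R(r, -) ⊆ R(r, -)`: the maps with domain `r` that factor through an object of degree less
than `deg r`. -/
def coboundary : Subfunctor (coyoneda.obj (op r)) where
  obj s := {f : r ⟶ s | ∃ (t : R) (a : r ⟶ t) (b : t ⟶ s), ρ.deg t < ρ.deg r ∧ a ≫ b = f}
  map := by
    rintro s s' g f ⟨t, a, b, ht, rfl⟩
    exact ⟨t, a, b ≫ g, ht, by simp⟩

/-- `∂R(-, r) ⊆ R(-, r)`: the maps with codomain `r` that factor through an object of degree less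
than `deg r`. -/
def boundary : Subfunctor (yoneda.obj r) where
  obj s := {f : s.unop ⟶ r | ∃ (t : R) (a : s.unop ⟶ t) (b : t ⟶ r),
    ρ.deg t < ρ.deg r ∧ a ≫ b = f}
  map := by
    rintro s s' g f ⟨t, a, b, ht, rfl⟩
    exact ⟨t, g.unop ≫ a, b, ht, by simp⟩

end

end ReedyStructure

/-! ### Tensors and cotensors -/

/-- The bifunctor `(A, F) ↦ A ⊗ F`, where `(A ⊗ F)(s) = ∐_{F s} A`, for `F : R ⥤ Type`. -/
noncomputable def tensorFunctor (R : Type v) [SmallCategory R] (M : Type u) [Category.{v} M]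
    [HasColimits M] : M ⥤ (R ⥤ Type v) ⥤ (R ⥤ M) :=
  sigmaConst ⋙ Functor.whiskeringRight R (Type v) M

/-- The bifunctor `(G, E) ↦ E ⋔ G`, where `(E ⋔ G)(s) = ∏_{G s} E`, for `G : Rᵒᵖ ⥤ Type`. -/
noncomputable def cotensorFunctor (R : Type v) [SmallCategory R] (M : Type u) [Category.{v} M]
    [HasLimits M] : (Rᵒᵖ ⥤ Type v)ᵒᵖ ⥤ M ⥤ (R ⥤ M) :=
  (Functor.leftOpRightOpEquiv R (Type v)).functor ⋙
    (piConst ⋙ Functor.whiskeringRight R (Type v)ᵒᵖ M).flip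

namespace ReedyStructure

variable {R : Type v} [SmallCategory R] {Rm Rp : MorphismProperty R}
  [Rm.IsMultiplicative] [Rp.IsMultiplicative] (ρ : ReedyStructure Rm Rp ℕ)
  {M : Type u} [Category.{v} M]

/-- For `i : A ⟶ B` and the inclusion `κ : ∂R(r, -) ⟶ R(r, -)`, the pushout-product
`A ⊗ R(r, -) ⊔_{A ⊗ ∂R(r, -)} B ⊗ ∂R(r, -) ⟶ B ⊗ R(r, -)`. -/
noncomputable def pushoutTensor [HasColimits M] {A B : M} (i : A ⟶ B) (r : R) :=
  (Functor.PushoutObjObj.ofHasPushout (tensorFunctor R M) i (ρ.coboundary r).ι).ι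

/-- For `p : E ⟶ B` and the inclusion `κ : ∂R(-, r) ⟶ R(-, r)`, the pullback-cotensor
`E ⋔ R(-, r) ⟶ E ⋔ ∂R(-, r) ×_{B ⋔ ∂R(-, r)} B ⋔ R(-, r)`. -/
noncomputable def pullbackCotensor [HasLimits M] {E B : M} (p : E ⟶ B) (r : R) :=
  (Functor.PullbackObjObj.ofHasPullback (cotensorFunctor R M) (ρ.boundary r).ι p).π

/-- The class of the pushout-products of the maps `i` in `I` with the inclusions
`∂R(r, -) ⟶ R(r, -)`. -/
inductive pushoutTensorClass [HasColimits M] (I : MorphismProperty M) :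
    MorphismProperty (R ⥤ M)
  | mk {A B : M} (i : A ⟶ B) (hi : I i) (r : R) : pushoutTensorClass I (ρ.pushoutTensor i r)

/-- The class of the pullback-cotensors of the maps `p` in `X` with the inclusions
`∂R(-, r) ⟶ R(-, r)`. -/
inductive pullbackCotensorClass [HasLimits M] (X : MorphismProperty M) :
    MorphismProperty (R ⥤ M)
  | mk {E B : M} (p : E ⟶ B) (hp : X p) (r : R) :
      pullbackCotensorClass X (ρ.pullbackCotensor p r)

/-- The class of maps `τ` of `R ⥤ M` whose opposite, as a map of `Rᵒᵖ ⥤ Mᵒᵖ`, is the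
pushout-product of a map in `Xᵒᵖ` with one of the inclusions for the opposite Reedy category. -/
noncomputable def opPushoutTensorClass [HasLimits M] (X : MorphismProperty M) :
    MorphismProperty (R ⥤ M) :=
  ((ρ.op.pushoutTensorClass X.op).inverseImage (Functor.opHom R M)).unop

end ReedyStructure

end HomotopicalAlgebra

/-! The core is a statement about one weak factorization system (L, W) on M: the maps with all
relative latching maps in L and the maps with all relative matching maps in W form a weak
factorization system on `R ⥤ M` (`isWeakFactorizationSystem_reedy`).

Lifting goes by induction on the degree. Components chosen below deg r assemble into a map out of
the latching object of the source and a map into the matching object of the target. Extending them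
to r means lifting a relative latching map against a relative matching map
(`hasLiftingProperty_of_relative`).

Factorization makes no smallness assumption, so it does not use the generators. At stage n the
relative matching map at each r of degree n is factored in M as E r → F r → M_r E ×_{M_r Ψ} Ψ r.
Then F r ⊗ R(r, -) is glued to E along the union of E r ⊗ R(r, -) and F r ⊗ ∂R(r, -). This changes
nothing below degree n, places F r at r, and the inclusion of E lies in the left class. The colimit
over n is stationary in each degree, so its relative matching maps are the chosen W-parts up to
isomorphism (`exists_factorization`).

Generation is an adjunction. Maps X → E ⋔ R(-, r) are maps X r → E by Yoneda. Maps X → E ⋔ ∂R(-, r)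
are maps L_r X → E, because every element of ∂R(-, r) factors uniquely as a map of `Rm` followed by
a degree-raising map from lower degree. So τ lifts against the pullback-cotensor of p at r iff its
relative latching map at r lifts against p (`hasLiftingProperty_pullbackCotensor_iff`), and L = llp
X makes the left Reedy class the llp of the pullback-cotensors of X.

Applying this to both systems of M leaves the identification of the trivial classes
(`reedyLeft_trivialCofibrations`, `reedyRight_trivialFibrations`). Finally, cotensors are opposites
of tensors, so the two proposed generating classes agree up to isomorphism and have the same llp.

Lifting problems are phrased with families of maps (`LatchLift`, `MatchLift`) rather than with
colimits and limits; in this form duality is immediate. -/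

namespace HomotopicalAlgebra

/-! ### Choices by induction on the degree -/

/-- Construction by induction on the degree of a family of elements satisfying a binary
compatibility relation. -/
lemma exists_compatible_family {ι : Type*} {T : ι → Type*} (deg : ι → ℕ)
    (C : ∀ i j, T i → T j → Prop)
    (h : ∀ (i : ι) (t : ∀ j, deg j < deg i → T j),
      (∀ j k hj hk, deg j < deg k → C j k (t j hj) (t k hk)) →
        ∃ x : T i, ∀ j hj, C j i (t j hj) x) :
    ∃ t : ∀ i, T i, ∀ i j, deg i < deg j → C i j (t i) (t j) := by
  let P (n : ℕ) := { t : ∀ j, deg j < n → T j //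
    ∀ j k hj hk, deg j < deg k → C j k (t j hj) (t k hk) }
  have ext (n : ℕ) (p : P n) : ∃ q : P (n + 1), ∀ j hj, q.1 j (Nat.lt_succ_of_lt hj) = p.1 j hj := by
    have key (j : ι) (hj : deg j = n) : ∃ x : T j, ∀ k hk, C k j (p.1 k hk) x := by
      subst hj
      exact h j (fun k hk ↦ p.1 k hk) (fun _ _ _ _ h ↦ p.2 _ _ _ _ h)
    choose x hx using key
    -- All elements of degree n can be chosen independently, since compatibility is only required
    -- between different degrees.
    refine ⟨⟨fun j hj ↦ if hj' : deg j < n then p.1 j hj' else x j (by lia), ?_⟩, ?_⟩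
    · intro j k hj hk hjk
      have hj' : deg j < n := by lia
      by_cases hk' : deg k < n
      · simpa [hj', hk'] using p.2 j k hj' hk' hjk
      · simpa [hj', hk'] using hx k (by lia) j hj'
    · intro j hj
      simp [hj]
  choose next hnext using ext
  let S (n : ℕ) : P n := Nat.rec ⟨fun j hj ↦ absurd hj (by lia), fun j k hj ↦ absurd hj (by lia)⟩
    (fun n p ↦ next n p) n
  have hS (n : ℕ) : S (n + 1) = next n (S n) := rfl
  have coh (m n : ℕ) (hmn : m ≤ n) : ∀ j (hj : deg j < m),
      (S n).1 j (hj.trans_le hmn) = (S m).1 j hj := by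
    induction n, hmn using Nat.le_induction with
    | base => exact fun _ _ ↦ rfl
    | succ n hmn ih =>
      intro j hj
      rw [← ih j hj, hS, hnext]
  -- The stage deg i + 1 is the first one at which i has a value; later stages do not change it.
  refine ⟨fun i ↦ (S (deg i + 1)).1 i (by lia), fun i j hij ↦ ?_⟩
  have h := (S (deg j + 1)).2 i j (by lia) (by lia) hij
  rwa [coh (deg i + 1) (deg j + 1) (by lia) i (by lia)] at h

/-! ### Factorizations in R, latching and matching families -/

namespace ReedyStructure

section

variable {R : Type v} [SmallCategory R] {Rm Rp : MorphismProperty R}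
  [Rm.IsMultiplicative] [Rp.IsMultiplicative] (ρ : ReedyStructure Rm Rp ℕ)

/-- The middle object of the canonical factorization has the least degree among all objects through
which f factors. This turns membership in the boundaries into a numerical condition. -/
lemma degHom_lt_iff_exists {r s : R} (f : r ⟶ s) (n : ℕ) :
    ρ.degHom f < n ↔ ∃ (t : R) (a : r ⟶ t) (b : t ⟶ s), ρ.deg t < n ∧ a ≫ b = f := by
  constructor
  · intro h
    obtain ⟨t, a, b, _, _, fac, h'⟩ := ρ.exists_fac f
    exact ⟨t, a, b, by lia, fac⟩
  · rintro ⟨t, a, b, h, rfl⟩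
    exact (ρ.degHom_le a b).trans_lt h

lemma mem_boundary_iff {r s : R} (f : s ⟶ r) :
    f ∈ (ρ.boundary r).obj (op s) ↔ ρ.degHom f < ρ.deg r :=
  (ρ.degHom_lt_iff_exists f _).symm

lemma degHom_eq_of_fac {r t s : R} (a : r ⟶ t) (b : t ⟶ s) (ha : Rm a) (hb : Rp b) :
    ρ.degHom (a ≫ b) = ρ.deg t :=
  ρ.degHom_eq (.mk t a b rfl ha hb)

lemma degHom_eq_of_prop₂ {r s : R} (f : r ⟶ s) (hf : Rp f) : ρ.degHom f = ρ.deg r := by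
  simpa using ρ.degHom_eq_of_fac (𝟙 r) f (Rm.id_mem _) hf

lemma degHom_eq_of_prop₁ {r s : R} (f : r ⟶ s) (hf : Rm f) : ρ.degHom f = ρ.deg s := by
  simpa using ρ.degHom_eq_of_fac f (𝟙 s) hf (Rp.id_mem _)

/-- Outside ∂R(r, -) the `Rm` part of a map does not lower the degree, so it is an identity. This
dichotomy drives the case analysis on cells. -/
lemma prop₂_of_not_degHom_lt {r s : R} (f : r ⟶ s) (hf : ¬ ρ.degHom f < ρ.deg r) : Rp f :=
  ρ.prop₂_of_degHom_eq_deg_left (le_antisymm (ρ.degHom_le_deg_left f) (not_lt.1 hf))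

/-- A map of `Rp` either is an identity or strictly raises the degree. -/
lemma eq_id_or_lt {r s : R} (f : r ⟶ s) (hf : Rp f) :
    (∃ h : r = s, f = eqToHom h) ∨ ρ.deg r < ρ.deg s := by
  by_cases h : ρ.deg r < ρ.deg s
  · exact Or.inr h
  · obtain ⟨_⟩ := ρ.identities_of_prop₂_of_eq hf (le_antisymm (ρ.le₂ f hf) (not_lt.1 h))
    exact Or.inl ⟨rfl, rfl⟩

/-- A map of `Rm` either is an identity or strictly lowers the degree. -/
lemma eq_id_or_lt' {r s : R} (f : r ⟶ s) (hf : Rm f) :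
    (∃ h : r = s, f = eqToHom h) ∨ ρ.deg s < ρ.deg r := by
  by_cases h : ρ.deg s < ρ.deg r
  · exact Or.inr h
  · obtain ⟨_⟩ := ρ.identities_of_prop₁_of_eq hf (le_antisymm (not_lt.1 h) (ρ.le₁ f hf))
    exact Or.inl ⟨rfl, rfl⟩

include ρ in
/-- Naturality can be checked separately on `Rm` and `Rp`. -/
lemma naturality_of_prop {M : Type*} [Category* M] {Φ Ψ : R ⥤ M} (h : ∀ r, Φ.obj r ⟶ Ψ.obj r)
    (h₁ : ∀ ⦃r s⦄ (f : r ⟶ s), Rm f → ρ.deg s < ρ.deg r → Φ.map f ≫ h s = h r ≫ Ψ.map f)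
    (h₂ : ∀ ⦃r s⦄ (f : r ⟶ s), Rp f → ρ.deg r < ρ.deg s → Φ.map f ≫ h s = h r ≫ Ψ.map f)
    ⦃r s : R⦄ (f : r ⟶ s) : Φ.map f ≫ h s = h r ≫ Ψ.map f := by
  have h₁' ⦃r s⦄ (f : r ⟶ s) (hf : Rm f) : Φ.map f ≫ h s = h r ≫ Ψ.map f := by
    obtain ⟨rfl, rfl⟩ | hlt := ρ.eq_id_or_lt' f hf
    · simp
    · exact h₁ f hf hlt
  have h₂' ⦃r s⦄ (f : r ⟶ s) (hf : Rp f) : Φ.map f ≫ h s = h r ≫ Ψ.map f := by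
    obtain ⟨rfl, rfl⟩ | hlt := ρ.eq_id_or_lt f hf
    · simp
    · exact h₂ f hf hlt
  obtain ⟨t, a, b, ha, hb, rfl, _⟩ := ρ.exists_fac f
  rw [Φ.map_comp, Category.assoc, h₂' b hb, ← Category.assoc, h₁' a ha, Category.assoc,
    Ψ.map_comp]

variable {M : Type u} [Category.{v} M]

/-- A compatible family of maps `Φ s ⟶ E`, indexed by the latching category of `r`. -/
structure LatchingFamily (r : R) (Φ : R ⥤ M) (E : M) where
  /-- the maps of the family -/
  app {s : R} (f : s ⟶ r) (hf : Rp f) (hs : ρ.deg s < ρ.deg r) : Φ.obj s ⟶ E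
  map_app {s t : R} (k : s ⟶ t) (f : t ⟶ r) (hk : Rp k) (hf : Rp f) (hs : ρ.deg s < ρ.deg r)
    (ht : ρ.deg t < ρ.deg r) :
    Φ.map k ≫ app f hf ht = app (k ≫ f) (Rp.comp_mem _ _ hk hf) hs

/-- A compatible family of maps `B ⟶ Φ s`, indexed by the matching category of `r`. -/
structure MatchingFamily (r : R) (B : M) (Φ : R ⥤ M) where
  /-- the maps of the family -/
  app {s : R} (f : r ⟶ s) (hf : Rm f) (hs : ρ.deg s < ρ.deg r) : B ⟶ Φ.obj s
  app_map {s t : R} (f : r ⟶ s) (k : s ⟶ t) (hf : Rm f) (hk : Rm k) (hs : ρ.deg s < ρ.deg r)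
    (ht : ρ.deg t < ρ.deg r) :
    app f hf hs ≫ Φ.map k = app (f ≫ k) (Rm.comp_mem _ _ hf hk) ht

variable {ρ}

/-- A latching family extends uniquely to a natural family indexed by `∂R(-, r)`. -/
lemma LatchingFamily.exists_extension {r : R} {Φ : R ⥤ M} {E : M} (l : ρ.LatchingFamily r Φ E) :
    ∃ l' : ∀ ⦃s : R⦄ (f : s ⟶ r), ρ.degHom f < ρ.deg r → (Φ.obj s ⟶ E),
      (∀ ⦃s : R⦄ (f : s ⟶ r) hf hs hf', l' f hf' = l.app f hf hs) ∧
      (∀ ⦃s t : R⦄ (k : s ⟶ t) (f : t ⟶ r) hf hkf, l' (k ≫ f) hkf = Φ.map k ≫ l' f hf) := by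
  -- The value on f is dictated by its factorization. Quantifying over all factorizations, which
  -- uniqueness allows, frees the later steps from the chosen one.
  have key ⦃s : R⦄ (f : s ⟶ r) (hf : ρ.degHom f < ρ.deg r) : ∃ x : Φ.obj s ⟶ E,
      ∀ (t : R) (a : s ⟶ t) (b : t ⟶ r) (_ : Rm a) (hb : Rp b) (_ : a ≫ b = f)
        (ht : ρ.deg t < ρ.deg r), x = Φ.map a ≫ l.app b hb ht := by
    obtain ⟨t, a, b, ha, hb, fac, h⟩ := ρ.exists_fac f
    refine ⟨Φ.map a ≫ l.app b hb (by lia), fun t' a' b' ha' hb' fac' ht' ↦ ?_⟩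
    obtain ⟨h, h', h''⟩ := ρ.unique (.mk t a b fac ha hb) (.mk t' a' b' fac' ha' hb')
    dsimp at h h' h''
    subst h
    obtain rfl : a = a' := by simpa using h'
    obtain rfl : b = b' := by simpa using h''
    rfl
  choose l' hl' using key
  refine ⟨l', fun s f hf hs hf' ↦ by
    simpa using hl' f hf' s (𝟙 s) f (Rm.id_mem _) hf (by simp) hs, fun s t k f hf hkf ↦ ?_⟩
  obtain ⟨t₁, a₁, b₁, ha₁, hb₁, fac₁, h₁⟩ := ρ.exists_fac f
  -- Refactoring `k ≫ a₁` gives the factorization of `k ≫ f` with raising part `b₂ ≫ b₁`, to which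
  -- `map_app` applies.
  obtain ⟨t₂, a₂, b₂, ha₂, hb₂, fac₂, h₂⟩ := ρ.exists_fac (k ≫ a₁)
  have h₂' := ρ.le₂ _ hb₂
  rw [hl' (k ≫ f) hkf t₂ a₂ (b₂ ≫ b₁) ha₂ (Rp.comp_mem _ _ hb₂ hb₁)
      (by rw [reassoc_of% fac₂, fac₁]) (by lia),
    hl' f hf t₁ a₁ b₁ ha₁ hb₁ fac₁ (by lia), ← l.map_app b₂ b₁ hb₂ hb₁ (by lia) (by lia),
    ← Φ.map_comp_assoc, ← Φ.map_comp_assoc, fac₂]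

/-- A matching family extends uniquely to a natural family indexed by `∂R(r, -)`. -/
lemma MatchingFamily.exists_extension {r : R} {B : M} {Φ : R ⥤ M} (m : ρ.MatchingFamily r B Φ) :
    ∃ m' : ∀ ⦃s : R⦄ (f : r ⟶ s), ρ.degHom f < ρ.deg r → (B ⟶ Φ.obj s),
      (∀ ⦃s : R⦄ (f : r ⟶ s) hf hs hf', m' f hf' = m.app f hf hs) ∧
      (∀ ⦃s t : R⦄ (f : r ⟶ s) (k : s ⟶ t) hf hfk, m' (f ≫ k) hfk = m' f hf ≫ Φ.map k) := by
  have key ⦃s : R⦄ (f : r ⟶ s) (hf : ρ.degHom f < ρ.deg r) : ∃ x : B ⟶ Φ.obj s,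
      ∀ (t : R) (a : r ⟶ t) (b : t ⟶ s) (ha : Rm a) (_ : Rp b) (_ : a ≫ b = f)
        (ht : ρ.deg t < ρ.deg r), x = m.app a ha ht ≫ Φ.map b := by
    obtain ⟨t, a, b, ha, hb, fac, h⟩ := ρ.exists_fac f
    refine ⟨m.app a ha (by lia) ≫ Φ.map b, fun t' a' b' ha' hb' fac' ht' ↦ ?_⟩
    obtain ⟨h, h', h''⟩ := ρ.unique (.mk t a b fac ha hb) (.mk t' a' b' fac' ha' hb')
    dsimp at h h' h''
    subst h
    obtain rfl : a = a' := by simpa using h'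
    obtain rfl : b = b' := by simpa using h''
    rfl
  choose m' hm' using key
  refine ⟨m', fun s f hf hs hf' ↦ by
    simpa using hm' f hf' s f (𝟙 s) hf (Rp.id_mem _) (by simp) hs, fun s t f k hf hfk ↦ ?_⟩
  obtain ⟨t₁, a₁, b₁, ha₁, hb₁, fac₁, h₁⟩ := ρ.exists_fac f
  obtain ⟨t₂, a₂, b₂, ha₂, hb₂, fac₂, h₂⟩ := ρ.exists_fac (b₁ ≫ k)
  have h₂' := ρ.le₁ _ ha₂
  rw [hm' (f ≫ k) hfk t₂ (a₁ ≫ a₂) b₂ (Rm.comp_mem _ _ ha₁ ha₂) hb₂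
      (by rw [Category.assoc, fac₂, reassoc_of% fac₁]) (by lia),
    hm' f hf t₁ a₁ b₁ ha₁ hb₁ fac₁ (by lia), ← m.app_map a₁ a₂ ha₁ ha₂ (by lia) (by lia),
    Category.assoc, Category.assoc, ← Φ.map_comp, ← Φ.map_comp, fac₂]

variable (ρ)

/-- The lifting property of the relative latching map of `τ` at `r` against `p`, in terms of
latching families. -/
def LatchLift {Φ Ψ : R ⥤ M} (τ : Φ ⟶ Ψ) (r : R) {E B : M} (p : E ⟶ B) : Prop :=
  ∀ (e : Φ.obj r ⟶ E) (l : ρ.LatchingFamily r Ψ E) (b : Ψ.obj r ⟶ B),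
    (∀ ⦃s : R⦄ (f : s ⟶ r) hf hs, Φ.map f ≫ e = τ.app s ≫ l.app f hf hs) →
    e ≫ p = τ.app r ≫ b →
    (∀ ⦃s : R⦄ (f : s ⟶ r) hf hs, l.app f hf hs ≫ p = Ψ.map f ≫ b) →
      ∃ h : Ψ.obj r ⟶ E, τ.app r ≫ h = e ∧
        (∀ ⦃s : R⦄ (f : s ⟶ r) hf hs, Ψ.map f ≫ h = l.app f hf hs) ∧ h ≫ p = b

/-- The lifting property of `i` against the relative matching map of `π` at `r`, in terms of
matching families. -/
def MatchLift {A B : M} (i : A ⟶ B) (r : R) {Φ Ψ : R ⥤ M} (π : Φ ⟶ Ψ) : Prop :=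
  ∀ (a : A ⟶ Φ.obj r) (m : ρ.MatchingFamily r B Φ) (b : B ⟶ Ψ.obj r),
    (∀ ⦃s : R⦄ (f : r ⟶ s) hf hs, a ≫ Φ.map f = i ≫ m.app f hf hs) →
    a ≫ π.app r = i ≫ b →
    (∀ ⦃s : R⦄ (f : r ⟶ s) hf hs, m.app f hf hs ≫ π.app s = b ≫ Ψ.map f) →
      ∃ h : B ⟶ Φ.obj r, i ≫ h = a ∧
        (∀ ⦃s : R⦄ (f : r ⟶ s) hf hs, h ≫ Φ.map f = m.app f hf hs) ∧ h ≫ π.app r = b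

section

variable [HasColimits M] (r : R)

/-- The map `Φ s ⟶ L_r Φ`. -/
noncomputable def latchingι (Φ : R ⥤ M) {s : R} (f : s ⟶ r) (hf : Rp f)
    (hs : ρ.deg s < ρ.deg r) : Φ.obj s ⟶ ρ.latchingObj r Φ :=
  colimit.ι (ρ.latchingForget r ⋙ Φ) ⟨MorphismProperty.Over.mk Rp f hf, hs⟩

variable {r}

lemma latchingObj_hom_ext {Φ : R ⥤ M} {E : M} {a b : ρ.latchingObj r Φ ⟶ E}
    (h : ∀ ⦃s : R⦄ (f : s ⟶ r) hf hs, ρ.latchingι r Φ f hf hs ≫ a = ρ.latchingι r Φ f hf hs ≫ b) :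
    a = b :=
  colimit.hom_ext (fun j ↦ h j.obj.hom j.obj.prop j.property)

lemma map_latchingι (Φ : R ⥤ M) {s t : R} (k : s ⟶ t) (f : t ⟶ r) (hk : Rp k) (hf : Rp f)
    (hs : ρ.deg s < ρ.deg r) (ht : ρ.deg t < ρ.deg r) :
    Φ.map k ≫ ρ.latchingι r Φ f hf ht =
      ρ.latchingι r Φ (k ≫ f) (Rp.comp_mem _ _ hk hf) hs :=
  colimit.w (ρ.latchingForget r ⋙ Φ)
    (j' := ⟨MorphismProperty.Over.mk Rp (k ≫ f) (Rp.comp_mem _ _ hk hf), hs⟩)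
    (j := ⟨MorphismProperty.Over.mk Rp f hf, ht⟩)
    ⟨MorphismProperty.Over.homMk (A := MorphismProperty.Over.mk Rp (k ≫ f) (Rp.comp_mem _ _ hk hf))
      (B := MorphismProperty.Over.mk Rp f hf) k rfl hk⟩

lemma latchingι_latchingMap (Φ : R ⥤ M) {s : R} (f : s ⟶ r) (hf : Rp f)
    (hs : ρ.deg s < ρ.deg r) : ρ.latchingι r Φ f hf hs ≫ ρ.latchingMap r Φ = Φ.map f :=
  colimit.ι_desc (ρ.latchingCocone r Φ) _

lemma latchingι_latchingMap_assoc (Φ : R ⥤ M) {s : R} (f : s ⟶ r) (hf : Rp f)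
    (hs : ρ.deg s < ρ.deg r) {Y : M}
    (h : _ ⟶ Y) :
    ρ.latchingι r Φ f hf hs ≫ ρ.latchingMap r Φ ≫ h =
      Φ.map f ≫ h := by
  rw [reassoc_of% latchingι_latchingMap]

lemma latchingι_latchingObjMap {Φ Ψ : R ⥤ M} (τ : Φ ⟶ Ψ) {s : R} (f : s ⟶ r) (hf : Rp f)
    (hs : ρ.deg s < ρ.deg r) :
    ρ.latchingι r Φ f hf hs ≫ ρ.latchingObjMap r τ = τ.app s ≫ ρ.latchingι r Ψ f hf hs :=
  ι_colimMap (Functor.whiskerLeft (ρ.latchingForget r) τ) _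

lemma latchingι_latchingObjMap_assoc {Φ Ψ : R ⥤ M} (τ : Φ ⟶ Ψ) {s : R} (f : s ⟶ r) (hf : Rp f)
    (hs : ρ.deg s < ρ.deg r) {Y : M}
    (h : _ ⟶ Y) :
    ρ.latchingι r Φ f hf hs ≫ ρ.latchingObjMap r τ ≫ h =
      τ.app s ≫ ρ.latchingι r Ψ f hf hs ≫ h := by
  rw [reassoc_of% latchingι_latchingObjMap]

variable {ρ}

/-- The map `L_r Φ ⟶ E` induced by a latching family. -/
noncomputable def LatchingFamily.desc {Φ : R ⥤ M} {E : M} (l : ρ.LatchingFamily r Φ E) :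
    ρ.latchingObj r Φ ⟶ E :=
  colimit.desc (ρ.latchingForget r ⋙ Φ)
    { pt := E
      ι :=
        { app j := l.app j.obj.hom j.obj.prop j.property
          naturality j j' k := by
            have h : k.hom.left ≫ j'.obj.hom = j.obj.hom := MorphismProperty.Over.w k.hom
            have h' := l.map_app k.hom.left j'.obj.hom k.hom.prop_hom_left j'.obj.prop
              j.property j'.property
            refine (h'.trans ?_).trans (Category.comp_id _).symm
            congr 1 } }

@[simp]
lemma LatchingFamily.ι_desc {Φ : R ⥤ M} {E : M} (l : ρ.LatchingFamily r Φ E) {s : R}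
    (f : s ⟶ r) (hf : Rp f) (hs : ρ.deg s < ρ.deg r) :
    ρ.latchingι r Φ f hf hs ≫ l.desc = l.app f hf hs :=
  colimit.ι_desc _ _

@[simp]
lemma LatchingFamily.ι_desc_assoc {Φ : R ⥤ M} {E : M} (l : ρ.LatchingFamily r Φ E) {s : R}
    (f : s ⟶ r) (hf : Rp f) (hs : ρ.deg s < ρ.deg r) {Y : M}
    (h : _ ⟶ Y) :
    ρ.latchingι r Φ f hf hs ≫ l.desc ≫ h =
      l.app f hf hs ≫ h := by
  rw [reassoc_of% LatchingFamily.ι_desc]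

variable (ρ)

/-- The latching family given by the inclusions in `L_r Φ`, followed by a map `L_r Φ ⟶ E`. -/
@[simps]
noncomputable def latchingFamily {Φ : R ⥤ M} {E : M} (a : ρ.latchingObj r Φ ⟶ E) :
    ρ.LatchingFamily r Φ E where
  app f hf hs := ρ.latchingι r Φ f hf hs ≫ a
  map_app k f hk hf hs ht := by rw [← Category.assoc, ρ.map_latchingι Φ k f hk hf hs ht]

lemma inl_relativeLatchingMap {Φ Ψ : R ⥤ M} (τ : Φ ⟶ Ψ) :
    pushout.inl _ _ ≫ ρ.relativeLatchingMap r τ = τ.app r :=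
  pushout.inl_desc _ _ _

lemma inl_relativeLatchingMap_assoc {Φ Ψ : R ⥤ M} (τ : Φ ⟶ Ψ) {Y : M}
    (h : _ ⟶ Y) :
    pushout.inl _ _ ≫ ρ.relativeLatchingMap r τ ≫ h =
      τ.app r ≫ h := by
  rw [reassoc_of% inl_relativeLatchingMap]

lemma inr_relativeLatchingMap {Φ Ψ : R ⥤ M} (τ : Φ ⟶ Ψ) :
    pushout.inr _ _ ≫ ρ.relativeLatchingMap r τ = ρ.latchingMap r Ψ :=
  pushout.inr_desc _ _ _

lemma inr_relativeLatchingMap_assoc {Φ Ψ : R ⥤ M} (τ : Φ ⟶ Ψ) {Y : M}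
    (h : _ ⟶ Y) :
    pushout.inr _ _ ≫ ρ.relativeLatchingMap r τ ≫ h =
      ρ.latchingMap r Ψ ≫ h := by
  rw [reassoc_of% inr_relativeLatchingMap]

/-- Unfolding the universal properties of the pushout and of L_r: a map out of the pushout is a map
out of Φ r with a latching family on Ψ agreeing over L_r Φ. -/
lemma hasLiftingProperty_relativeLatchingMap_iff {Φ Ψ : R ⥤ M} (τ : Φ ⟶ Ψ) {E B : M}
    (p : E ⟶ B) : HasLiftingProperty (ρ.relativeLatchingMap r τ) p ↔ ρ.LatchLift τ r p := by
  constructor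
  · intro _ e l b h₁ h₂ h₃
    have w : ρ.latchingMap r Φ ≫ e = ρ.latchingObjMap r τ ≫ l.desc :=
      ρ.latchingObj_hom_ext fun s f hf hs ↦ by
        rw [latchingι_latchingMap_assoc, latchingι_latchingObjMap_assoc, h₁ f hf hs, l.ι_desc]
    have sq : CommSq (pushout.desc e l.desc w) (ρ.relativeLatchingMap r τ) p b := ⟨by
      apply pushout.hom_ext
      · rw [pushout.inl_desc_assoc, inl_relativeLatchingMap_assoc, h₂]
      · refine ρ.latchingObj_hom_ext fun s f hf hs ↦ ?_
        rw [pushout.inr_desc_assoc, inr_relativeLatchingMap_assoc, latchingι_latchingMap_assoc,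
          l.ι_desc_assoc, h₃]⟩
    obtain ⟨h, hl, hr⟩ : ∃ h, ρ.relativeLatchingMap r τ ≫ h = pushout.desc e l.desc w ∧ h ≫ p = b :=
      ⟨sq.lift, sq.fac_left, sq.fac_right⟩
    refine ⟨h, ?_, fun s f hf hs ↦ ?_, hr⟩
    · rw [← ρ.inl_relativeLatchingMap_assoc τ, hl, pushout.inl_desc]
    · rw [← ρ.latchingι_latchingMap_assoc Ψ f hf hs, ← ρ.inr_relativeLatchingMap_assoc τ, hl,
        pushout.inr_desc, l.ι_desc]
  · intro H
    refine ⟨fun {e b} sq ↦ ?_⟩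
    obtain ⟨h, h₁, h₂, h₃⟩ := H (pushout.inl _ _ ≫ e) (ρ.latchingFamily (pushout.inr _ _ ≫ e)) b
      (fun s f hf hs ↦ by
        rw [latchingFamily_app, ← latchingι_latchingObjMap_assoc, ← pushout.condition_assoc,
          latchingι_latchingMap_assoc])
      (by rw [Category.assoc, sq.w, inl_relativeLatchingMap_assoc])
      (fun s f hf hs ↦ by
        rw [latchingFamily_app, Category.assoc, Category.assoc, sq.w,
          inr_relativeLatchingMap_assoc, latchingι_latchingMap_assoc])
    refine ⟨⟨h, ?_, h₃⟩⟩
    apply pushout.hom_ext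
    · rw [inl_relativeLatchingMap_assoc, h₁]
    · refine ρ.latchingObj_hom_ext fun s f hf hs ↦ ?_
      rw [inr_relativeLatchingMap_assoc, latchingι_latchingMap_assoc, h₂, latchingFamily_app]

end

section

variable [HasLimits M] (r : R)

/-- The map `M_r Φ ⟶ Φ s`. -/
noncomputable def matchingπ (Φ : R ⥤ M) {s : R} (f : r ⟶ s) (hf : Rm f)
    (hs : ρ.deg s < ρ.deg r) : ρ.matchingObj r Φ ⟶ Φ.obj s :=
  limit.π (ρ.matchingForget r ⋙ Φ) ⟨MorphismProperty.Under.mk Rm f hf, hs⟩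

variable {r}

lemma matchingObj_hom_ext {Φ : R ⥤ M} {B : M} {a b : B ⟶ ρ.matchingObj r Φ}
    (h : ∀ ⦃s : R⦄ (f : r ⟶ s) hf hs, a ≫ ρ.matchingπ r Φ f hf hs = b ≫ ρ.matchingπ r Φ f hf hs) :
    a = b :=
  limit.hom_ext (fun j ↦ h j.obj.hom j.obj.prop j.property)

lemma matchingπ_map (Φ : R ⥤ M) {s t : R} (f : r ⟶ s) (k : s ⟶ t) (hf : Rm f) (hk : Rm k)
    (hs : ρ.deg s < ρ.deg r) (ht : ρ.deg t < ρ.deg r) :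
    ρ.matchingπ r Φ f hf hs ≫ Φ.map k =
      ρ.matchingπ r Φ (f ≫ k) (Rm.comp_mem _ _ hf hk) ht :=
  limit.w (ρ.matchingForget r ⋙ Φ)
    (j := ⟨MorphismProperty.Under.mk Rm f hf, hs⟩)
    (j' := ⟨MorphismProperty.Under.mk Rm (f ≫ k) (Rm.comp_mem _ _ hf hk), ht⟩)
    ⟨MorphismProperty.Under.homMk k rfl hk⟩

lemma matchingMap_matchingπ (Φ : R ⥤ M) {s : R} (f : r ⟶ s) (hf : Rm f)
    (hs : ρ.deg s < ρ.deg r) : ρ.matchingMap r Φ ≫ ρ.matchingπ r Φ f hf hs = Φ.map f :=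
  limit.lift_π (ρ.matchingCone r Φ) _

lemma matchingObjMap_matchingπ {Φ Ψ : R ⥤ M} (τ : Φ ⟶ Ψ) {s : R} (f : r ⟶ s) (hf : Rm f)
    (hs : ρ.deg s < ρ.deg r) :
    ρ.matchingObjMap r τ ≫ ρ.matchingπ r Ψ f hf hs = ρ.matchingπ r Φ f hf hs ≫ τ.app s :=
  limMap_π (Functor.whiskerLeft (ρ.matchingForget r) τ) _

variable {ρ}

/-- The map `B ⟶ M_r Φ` induced by a matching family. -/
noncomputable def MatchingFamily.lift {Φ : R ⥤ M} {B : M} (m : ρ.MatchingFamily r B Φ) :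
    B ⟶ ρ.matchingObj r Φ :=
  limit.lift (ρ.matchingForget r ⋙ Φ)
    { pt := B
      π :=
        { app j := m.app j.obj.hom j.obj.prop j.property
          naturality j j' k := by
            have h : j.obj.hom ≫ k.hom.right = j'.obj.hom := MorphismProperty.Under.w k.hom
            have h' := m.app_map j.obj.hom k.hom.right j.obj.prop k.hom.prop_hom_right
              j.property j'.property
            refine (Category.id_comp _).trans (Eq.trans ?_ h'.symm)
            congr 1
            exact h.symm } }

@[simp]
lemma MatchingFamily.lift_π {Φ : R ⥤ M} {B : M} (m : ρ.MatchingFamily r B Φ) {s : R}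
    (f : r ⟶ s) (hf : Rm f) (hs : ρ.deg s < ρ.deg r) :
    m.lift ≫ ρ.matchingπ r Φ f hf hs = m.app f hf hs :=
  limit.lift_π _ _

@[simp]
lemma MatchingFamily.lift_π_assoc {Φ : R ⥤ M} {B : M} (m : ρ.MatchingFamily r B Φ) {s : R}
    (f : r ⟶ s) (hf : Rm f) (hs : ρ.deg s < ρ.deg r) {Y : M}
    (h : _ ⟶ Y) :
    m.lift ≫ ρ.matchingπ r Φ f hf hs ≫ h =
      m.app f hf hs ≫ h := by
  rw [reassoc_of% MatchingFamily.lift_π]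

variable (ρ)

/-- The matching family given by a map `B ⟶ M_r Φ`, followed by the projections. -/
@[simps]
noncomputable def matchingFamily {Φ : R ⥤ M} {B : M} (a : B ⟶ ρ.matchingObj r Φ) :
    ρ.MatchingFamily r B Φ where
  app f hf hs := a ≫ ρ.matchingπ r Φ f hf hs
  app_map f k hf hk hs ht := by rw [Category.assoc, ρ.matchingπ_map Φ f k hf hk hs ht]

lemma relativeMatchingMap_fst {Φ Ψ : R ⥤ M} (π : Φ ⟶ Ψ) :
    ρ.relativeMatchingMap r π ≫ pullback.fst _ _ = ρ.matchingMap r Φ :=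
  pullback.lift_fst _ _ _

lemma relativeMatchingMap_fst_assoc {Φ Ψ : R ⥤ M} (π : Φ ⟶ Ψ) {Y : M}
    (h : _ ⟶ Y) :
    ρ.relativeMatchingMap r π ≫ pullback.fst _ _ ≫ h =
      ρ.matchingMap r Φ ≫ h := by
  rw [reassoc_of% relativeMatchingMap_fst]

lemma relativeMatchingMap_snd {Φ Ψ : R ⥤ M} (π : Φ ⟶ Ψ) :
    ρ.relativeMatchingMap r π ≫ pullback.snd _ _ = π.app r :=
  pullback.lift_snd _ _ _

lemma hasLiftingProperty_relativeMatchingMap_iff {A B : M} (i : A ⟶ B) {Φ Ψ : R ⥤ M}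
    (π : Φ ⟶ Ψ) : HasLiftingProperty i (ρ.relativeMatchingMap r π) ↔ ρ.MatchLift i r π := by
  constructor
  · intro _ a m b h₁ h₂ h₃
    have w : m.lift ≫ ρ.matchingObjMap r π = b ≫ ρ.matchingMap r Ψ :=
      ρ.matchingObj_hom_ext fun s f hf hs ↦ by
        rw [Category.assoc, Category.assoc, matchingObjMap_matchingπ, matchingMap_matchingπ,
          m.lift_π_assoc, h₃]
    have sq : CommSq a i (ρ.relativeMatchingMap r π) (pullback.lift m.lift b w) := ⟨by
      apply pullback.hom_ext
      · refine ρ.matchingObj_hom_ext fun s f hf hs ↦ ?_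
        rw [Category.assoc, Category.assoc, Category.assoc, relativeMatchingMap_fst_assoc,
          matchingMap_matchingπ, Category.assoc, pullback.lift_fst_assoc, m.lift_π, h₁]
      · rw [Category.assoc, Category.assoc, relativeMatchingMap_snd, pullback.lift_snd, h₂]⟩
    obtain ⟨h, hl, hr⟩ : ∃ h, i ≫ h = a ∧
        h ≫ ρ.relativeMatchingMap r π = pullback.lift m.lift b w :=
      ⟨sq.lift, sq.fac_left, sq.fac_right⟩
    refine ⟨h, hl, fun s f hf hs ↦ ?_, ?_⟩
    · rw [← ρ.matchingMap_matchingπ Φ f hf hs, ← ρ.relativeMatchingMap_fst π, Category.assoc,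
        reassoc_of% hr, pullback.lift_fst_assoc, m.lift_π]
    · rw [← ρ.relativeMatchingMap_snd π, reassoc_of% hr, pullback.lift_snd]
  · intro H
    refine ⟨fun {a b} sq ↦ ?_⟩
    have w := sq.w
    obtain ⟨h, h₁, h₂, h₃⟩ := H a (ρ.matchingFamily (b ≫ pullback.fst _ _)) (b ≫ pullback.snd _ _)
      (fun s f hf hs ↦ by
        rw [matchingFamily_app, Category.assoc, ← reassoc_of% w,
          relativeMatchingMap_fst_assoc, matchingMap_matchingπ])
      (by rw [← reassoc_of% w, relativeMatchingMap_snd])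
      (fun s f hf hs ↦ by
        rw [matchingFamily_app, Category.assoc, Category.assoc, ← matchingObjMap_matchingπ,
          pullback.condition_assoc, matchingMap_matchingπ, Category.assoc])
    refine ⟨⟨h, h₁, ?_⟩⟩
    apply pullback.hom_ext
    · refine ρ.matchingObj_hom_ext fun s f hf hs ↦ ?_
      rw [Category.assoc, Category.assoc, relativeMatchingMap_fst_assoc, matchingMap_matchingπ, h₂,
        matchingFamily_app]
    · rw [Category.assoc, relativeMatchingMap_snd, h₃]

end

end

end ReedyStructure

end HomotopicalAlgebra

/-! ### Lifting by induction on the degree -/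

namespace HomotopicalAlgebra

namespace ReedyStructure

section

variable {R : Type v} [SmallCategory R] {Rm Rp : MorphismProperty R}
  [Rm.IsMultiplicative] [Rp.IsMultiplicative] (ρ : ReedyStructure Rm Rp ℕ)
  {M : Type u} [Category.{v} M]

/-- The lifting property for natural transformations, by induction on the degree. -/
lemma hasLiftingProperty_of_relative [HasLimits M] [HasColimits M] {Φ Ψ Φ' Ψ' : R ⥤ M}
    (τ : Φ ⟶ Ψ) (π : Φ' ⟶ Ψ')
    (H : ∀ r, HasLiftingProperty (ρ.relativeLatchingMap r τ) (ρ.relativeMatchingMap r π)) :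
    HasLiftingProperty τ π := by
  refine ⟨fun {u w} sq ↦ ?_⟩
  have sqw (r : R) : u.app r ≫ π.app r = τ.app r ≫ w.app r := congrArg (·.app r) sq.w
  let T (r : R) := { h : Ψ.obj r ⟶ Φ'.obj r // τ.app r ≫ h = u.app r ∧ h ≫ π.app r = w.app r }
  let C (s r : R) (hs : T s) (hr : T r) : Prop :=
    (∀ f : s ⟶ r, Rp f → Ψ.map f ≫ hr.1 = hs.1 ≫ Φ'.map f) ∧
    (∀ f : r ⟶ s, Rm f → Ψ.map f ≫ hs.1 = hr.1 ≫ Φ'.map f)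
  obtain ⟨t, ht⟩ := exists_compatible_family ρ.deg C (fun r t ht ↦ by
    have nat₂ {s s' : R} (hs hs') (k : s ⟶ s') (hk : Rp k) :
        Ψ.map k ≫ (t s' hs').1 = (t s hs).1 ≫ Φ'.map k := by
      obtain ⟨rfl, rfl⟩ | hlt := ρ.eq_id_or_lt k hk
      · simp
      · exact (ht s s' hs hs' hlt).1 k hk
    have nat₁ {s s' : R} (hs hs') (k : s ⟶ s') (hk : Rm k) :
        Ψ.map k ≫ (t s' hs').1 = (t s hs).1 ≫ Φ'.map k := by
      obtain ⟨rfl, rfl⟩ | hlt := ρ.eq_id_or_lt' k hk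
      · simp
      · exact (ht s' s hs' hs hlt).2 k hk
    -- The middle object of k has degree at most deg s', hence below deg r, so its component is
    -- already chosen.
    have nat {s s' : R} (hs hs') (k : s ⟶ s') :
        Ψ.map k ≫ (t s' hs').1 = (t s hs).1 ≫ Φ'.map k := by
      obtain ⟨x, a, b, ha, hb, rfl, _⟩ := ρ.exists_fac k
      have hx : ρ.deg x < ρ.deg r := (ρ.le₂ b hb).trans_lt hs'
      rw [Ψ.map_comp, Category.assoc, nat₂ hx hs' b hb, reassoc_of% nat₁ hs hx a ha,
        Φ'.map_comp]
    let l : ρ.LatchingFamily r Ψ (Φ'.obj r) :=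
      { app f hf hs := (t _ hs).1 ≫ Φ'.map f
        map_app {s s'} k f hk hf hs hs' := by
          rw [reassoc_of% nat hs hs' k, Φ'.map_comp] }
    let m : ρ.MatchingFamily r (Ψ.obj r) Φ' :=
      { app f hf hs := Ψ.map f ≫ (t _ hs).1
        app_map {s s'} f k hf hk hs hs' := by
          rw [Category.assoc, ← nat hs hs' k, Ψ.map_comp, Category.assoc] }
    have hm : m.lift ≫ ρ.matchingObjMap r π = w.app r ≫ ρ.matchingMap r Ψ' :=
      ρ.matchingObj_hom_ext fun s f hf hs ↦ by
        rw [Category.assoc, Category.assoc, matchingObjMap_matchingπ, matchingMap_matchingπ,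
          m.lift_π_assoc, Category.assoc, (t s hs).2.2, w.naturality]
    obtain ⟨h, h₁, h₂, h₃⟩ := (ρ.hasLiftingProperty_relativeLatchingMap_iff τ _).1 (H r)
      (u.app r) l (pullback.lift m.lift (w.app r) hm)
      (fun s f hf hs ↦ by
        rw [u.naturality, ← (t s hs).2.1, Category.assoc])
      (by
        apply pullback.hom_ext
        · refine ρ.matchingObj_hom_ext fun s f hf hs ↦ ?_
          rw [Category.assoc, Category.assoc, Category.assoc, relativeMatchingMap_fst_assoc,
            matchingMap_matchingπ, Category.assoc, pullback.lift_fst_assoc, m.lift_π,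
            ← u.naturality, ← (t s hs).2.1, τ.naturality_assoc]
        · rw [Category.assoc, Category.assoc, relativeMatchingMap_snd, pullback.lift_snd, sqw])
      (fun s f hf hs ↦ by
        apply pullback.hom_ext
        · refine ρ.matchingObj_hom_ext fun s' f' hf' hs' ↦ ?_
          simp only [Category.assoc]
          rw [relativeMatchingMap_fst_assoc, matchingMap_matchingπ, pullback.lift_fst_assoc,
            m.lift_π]
          -- The composite `f ≫ f'` runs from s through r to s' and need be neither raising nor
          -- lowering, which is why `nat` is needed for arbitrary maps.
          change ((t s hs).1 ≫ Φ'.map f) ≫ Φ'.map f' = Ψ.map f ≫ Ψ.map f' ≫ (t s' hs').1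
          rw [Category.assoc, ← Φ'.map_comp, ← nat hs hs', Ψ.map_comp, Category.assoc]
        · rw [Category.assoc, Category.assoc, relativeMatchingMap_snd, Category.assoc,
            pullback.lift_snd, π.naturality, reassoc_of% (t s hs).2.2, w.naturality])
    refine ⟨⟨h, h₁, ?_⟩, fun s hs ↦ ⟨fun f hf ↦ h₂ f hf hs, fun f hf ↦ ?_⟩⟩
    · rw [← ρ.relativeMatchingMap_snd π, reassoc_of% h₃, pullback.lift_snd]
    · have := congrArg (· ≫ pullback.fst _ _ ≫ ρ.matchingπ r _ f hf hs) h₃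
      simp only [Category.assoc] at this
      rw [relativeMatchingMap_fst_assoc, matchingMap_matchingπ, pullback.lift_fst_assoc,
        m.lift_π] at this
      exact this.symm)
  refine ⟨⟨⟨{ app r := (t r).1, naturality := ?_ }, ?_, ?_⟩⟩⟩
  · refine ρ.naturality_of_prop (fun r ↦ (t r).1) (fun r s f hf hlt ↦ ?_) (fun r s f hf hlt ↦ ?_)
    · exact (ht _ _ hlt).2 f hf
    · exact (ht _ _ hlt).1 f hf
  · ext r
    exact (t r).2.1
  · ext r
    exact (t r).2.2

/-- Solutions of the lifting problems over the category of degree-raising maps `s ⟶ r` with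
`deg s < N` can be chosen compatibly. -/
lemma exists_lift_family_of_latchLift {Φ Ψ : R ⥤ M} (τ : Φ ⟶ Ψ) {E B : M} (p : E ⟶ B)
    (N : ℕ) (H : ∀ s, ρ.deg s < N → ρ.LatchLift τ s p) (r : R)
    (a : ∀ ⦃s⦄ (f : s ⟶ r), Rp f → ρ.deg s < N → (Φ.obj s ⟶ E))
    (b : ∀ ⦃s⦄ (f : s ⟶ r), Rp f → ρ.deg s < N → (Ψ.obj s ⟶ B))
    (ha : ∀ ⦃s t⦄ (k : s ⟶ t) (f : t ⟶ r) hk hf hs ht,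
      Φ.map k ≫ a f hf ht = a (k ≫ f) (Rp.comp_mem _ _ hk hf) hs)
    (hb : ∀ ⦃s t⦄ (k : s ⟶ t) (f : t ⟶ r) hk hf hs ht,
      Ψ.map k ≫ b f hf ht = b (k ≫ f) (Rp.comp_mem _ _ hk hf) hs)
    (hab : ∀ ⦃s⦄ (f : s ⟶ r) hf hs, a f hf hs ≫ p = τ.app s ≫ b f hf hs) :
    ∃ h : ∀ ⦃s⦄ (f : s ⟶ r), Rp f → ρ.deg s < N → (Ψ.obj s ⟶ E),
      (∀ ⦃s t⦄ (k : s ⟶ t) (f : t ⟶ r) hk hf hs ht,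
        Ψ.map k ≫ h f hf ht = h (k ≫ f) (Rp.comp_mem _ _ hk hf) hs) ∧
      (∀ ⦃s⦄ (f : s ⟶ r) hf hs, τ.app s ≫ h f hf hs = a f hf hs) ∧
      (∀ ⦃s⦄ (f : s ⟶ r) hf hs, h f hf hs ≫ p = b f hf hs) := by
  let ι := { x : Σ s, (s ⟶ r) // Rp x.2 ∧ ρ.deg x.1 < N }
  let T (x : ι) := { h : Ψ.obj x.1.1 ⟶ E //
    τ.app x.1.1 ≫ h = a x.1.2 x.2.1 x.2.2 ∧ h ≫ p = b x.1.2 x.2.1 x.2.2 }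
  let C (x y : ι) (hx : T x) (hy : T y) : Prop :=
    ∀ k : x.1.1 ⟶ y.1.1, Rp k → k ≫ y.1.2 = x.1.2 → Ψ.map k ≫ hy.1 = hx.1
  obtain ⟨t, ht⟩ := exists_compatible_family (fun x : ι ↦ ρ.deg x.1.1) C (fun x t ht ↦ by
    obtain ⟨⟨s, f⟩, hf, hs⟩ := x
    let y {s'} (k : s' ⟶ s) (hk : Rp k) (hs' : ρ.deg s' < ρ.deg s) : ι :=
      ⟨⟨s', k ≫ f⟩, Rp.comp_mem _ _ hk hf, hs'.trans hs⟩
    let l : ρ.LatchingFamily s Ψ E :=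
      { app k hk hs' := (t (y k hk hs') hs').1
        map_app {s₁ s₂} k g hk hg hs₁ hs₂ := by
          -- `C` only compares indices of different degree. For an identity k, the indices of g and
          -- `𝟙 ≫ g` are merely propositionally equal, so the equality is transported.
          obtain ⟨rfl, rfl⟩ | hlt := ρ.eq_id_or_lt k hk
          · have aux : ∀ (g' : s₁ ⟶ s) (hg' : Rp g'), g' = g →
                (t (y g hg hs₂) hs₂).1 = (t (y g' hg' hs₁) hs₁).1 := by
              rintro _ _ rfl
              rfl
            simpa using aux (𝟙 s₁ ≫ g) (Rp.comp_mem _ _ hk hg) (Category.id_comp g)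
          · exact ht (y (k ≫ g) (Rp.comp_mem _ _ hk hg) hs₁) (y g hg hs₂) hs₁ hs₂ hlt k hk (by simp [y]) }
    obtain ⟨h, h₁, h₂, h₃⟩ := H s hs (a f hf hs) l (b f hf hs)
      (fun s' k hk hs' ↦ by
        rw [ha k f hk hf (hs'.trans hs) hs]
        exact (t (y k hk hs') hs').2.1.symm)
      (hab f hf hs)
      (fun s' k hk hs' ↦ by
        rw [hb k f hk hf (hs'.trans hs) hs]
        exact (t (y k hk hs') hs').2.2)
    refine ⟨⟨h, h₁, h₃⟩, ?_⟩
    rintro ⟨⟨s', f'⟩, hf', hs'⟩ hlt k hk fac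
    dsimp at k fac hlt
    subst fac
    exact h₂ k hk hlt)
  refine ⟨fun s f hf hs ↦ (t ⟨⟨s, f⟩, hf, hs⟩).1, fun s s' k f hk hf hs hs' ↦ ?_,
    fun s f hf hs ↦ (t ⟨⟨s, f⟩, hf, hs⟩).2.1, fun s f hf hs ↦ (t ⟨⟨s, f⟩, hf, hs⟩).2.2⟩
  obtain ⟨rfl, rfl⟩ | hlt := ρ.eq_id_or_lt k hk
  · have aux : ∀ (g : s ⟶ r) (hg : Rp g), g = f →
        (t ⟨⟨s, f⟩, hf, hs⟩).1 = (t ⟨⟨s, g⟩, hg, hs⟩).1 := by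
      rintro _ _ rfl
      rfl
    simpa using aux (𝟙 s ≫ f) (Rp.comp_mem _ _ hk hf) (Category.id_comp f)
  · exact ht ⟨⟨s, k ≫ f⟩, Rp.comp_mem _ _ hk hf, hs⟩ ⟨⟨s', f⟩, hf, hs'⟩ hlt k hk rfl

/-- With the bound deg r + 1 the raising maps to r include the identity, and the member of the
compatible family there is the lift. -/
lemma hasLiftingProperty_app_of_latchLift {Φ Ψ : R ⥤ M} (τ : Φ ⟶ Ψ) {E B : M} (p : E ⟶ B)
    (r : R) (H : ∀ s, ρ.deg s ≤ ρ.deg r → ρ.LatchLift τ s p) :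
    HasLiftingProperty (τ.app r) p := by
  refine ⟨fun {e b} sq ↦ ?_⟩
  obtain ⟨h, h₁, h₂, h₃⟩ := ρ.exists_lift_family_of_latchLift τ p (ρ.deg r + 1)
    (fun s hs ↦ H s (by lia)) r (fun s f _ _ ↦ Φ.map f ≫ e) (fun s f _ _ ↦ Ψ.map f ≫ b)
    (by simp) (by simp) (fun s f _ _ ↦ by rw [Category.assoc, sq.w, τ.naturality_assoc])
  exact ⟨⟨h (𝟙 r) (Rp.id_mem _) (by lia), by simp [h₂], by simp [h₃]⟩⟩

/-- With the bound deg r the compatible family of lifts is exactly a latching family, hence a map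
out of L_r Ψ. -/
lemma hasLiftingProperty_latchingObjMap_of_latchLift [HasColimits M] {Φ Ψ : R ⥤ M} (τ : Φ ⟶ Ψ)
    {E B : M} (p : E ⟶ B) (r : R) (H : ∀ s, ρ.deg s < ρ.deg r → ρ.LatchLift τ s p) :
    HasLiftingProperty (ρ.latchingObjMap r τ) p := by
  refine ⟨fun {e b} sq ↦ ?_⟩
  obtain ⟨h, h₁, h₂, h₃⟩ := ρ.exists_lift_family_of_latchLift τ p (ρ.deg r) H r
    (fun _ f hf hs ↦ (ρ.latchingFamily e).app f hf hs)
    (fun _ f hf hs ↦ (ρ.latchingFamily b).app f hf hs)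
    (fun _ _ k f hk hf hs ht ↦ (ρ.latchingFamily e).map_app k f hk hf hs ht)
    (fun _ _ k f hk hf hs ht ↦ (ρ.latchingFamily b).map_app k f hk hf hs ht)
    (fun s f hf hs ↦ by
      rw [latchingFamily_app, latchingFamily_app, Category.assoc, sq.w,
        latchingι_latchingObjMap_assoc])
  let l : ρ.LatchingFamily r Ψ E :=
    { app f hf hs := h f hf hs
      map_app k f hk hf hs ht := h₁ k f hk hf hs ht }
  refine ⟨⟨l.desc, ρ.latchingObj_hom_ext fun s f hf hs ↦ ?_,
    ρ.latchingObj_hom_ext fun s f hf hs ↦ ?_⟩⟩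
  · rw [latchingι_latchingObjMap_assoc, l.ι_desc, h₂, latchingFamily_app]
  · rw [l.ι_desc_assoc, h₃, latchingFamily_app]

/-! ### Duality -/

/-- Passing to opposites exchanges raising and lowering maps, and the two triangles of a lift. No
comparison of colimits in the opposite category with limits is involved. -/
lemma latchLift_op_iff {Φ Ψ : R ⥤ M} (π : Φ ⟶ Ψ) {A B : M} (i : A ⟶ B) (r : R) :
    ρ.op.LatchLift ((Functor.opHom R M).map π.op) (op r) i.op ↔ ρ.MatchLift i r π := by
  constructor
  · intro H a m b h₁ h₂ h₃
    obtain ⟨h, h₁', h₂', h₃'⟩ := H b.op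
      { app f hf hs := (m.app f.unop hf hs).op
        map_app k f hk hf hs ht := Quiver.Hom.unop_inj (m.app_map f.unop k.unop hf hk ht hs) }
      a.op (fun s f hf hs ↦ Quiver.Hom.unop_inj (h₃ f.unop hf hs).symm)
      (Quiver.Hom.unop_inj h₂.symm)
      (fun s f hf hs ↦ Quiver.Hom.unop_inj (h₁ f.unop hf hs).symm)
    exact ⟨h.unop, Quiver.Hom.op_inj h₃',
      fun s f hf hs ↦ Quiver.Hom.op_inj (h₂' f.op hf hs), Quiver.Hom.op_inj h₁'⟩
  · intro H e l b h₁ h₂ h₃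
    obtain ⟨h, h₁', h₂', h₃'⟩ := H b.unop
      { app {s} f hf hs := (l.app f.op hf hs).unop
        app_map {s t} f k hf hk hs ht :=
          Quiver.Hom.op_inj (l.map_app k.op f.op hk hf ht hs) }
      e.unop (fun s f hf hs ↦ Quiver.Hom.op_inj (h₃ f.op hf hs).symm)
      (Quiver.Hom.op_inj h₂.symm)
      (fun s f hf hs ↦ Quiver.Hom.op_inj (h₁ f.op hf hs).symm)
    exact ⟨h.op, Quiver.Hom.unop_inj h₃',
      fun s f hf hs ↦ Quiver.Hom.unop_inj (h₂' f.unop hf hs), Quiver.Hom.unop_inj h₁'⟩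

lemma hasLiftingProperty_app_of_matchLift {Φ Ψ : R ⥤ M} (π : Φ ⟶ Ψ) {A B : M} (i : A ⟶ B)
    (r : R) (H : ∀ s, ρ.deg s ≤ ρ.deg r → ρ.MatchLift i s π) :
    HasLiftingProperty i (π.app r) := by
  have := ρ.op.hasLiftingProperty_app_of_latchLift ((Functor.opHom R M).map π.op) i.op (op r)
    (fun s hs ↦ (ρ.latchLift_op_iff π i s.unop).2 (H _ hs))
  exact this.unop

end

end ReedyStructure

end HomotopicalAlgebra

/-! ### Cotensors and their adjunction with relative latching maps -/

namespace HomotopicalAlgebra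

section

variable {R : Type v} [SmallCategory R] {M : Type u} [Category.{v} M] [HasLimits M]

/-- The cotensor `E ⋔ G`. -/
noncomputable abbrev cotensor (G : Rᵒᵖ ⥤ Type v) (E : M) : R ⥤ M :=
  ((cotensorFunctor R M).obj (op G)).obj E

/-- The projection `(E ⋔ G)(s) ⟶ E` corresponding to `x : G s`. -/
noncomputable def cotensorπ (G : Rᵒᵖ ⥤ Type v) (E : M) (s : R) (x : G.obj (op s)) :
    (cotensor G E).obj s ⟶ E :=
  Pi.π (fun _ : G.obj (op s) ↦ E) x

lemma cotensor_obj_hom_ext {G : Rᵒᵖ ⥤ Type v} {E A : M} {s : R}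
    {a b : A ⟶ (cotensor G E).obj s}
    (h : ∀ x, a ≫ cotensorπ G E s x = b ≫ cotensorπ G E s x) : a = b :=
  Pi.hom_ext _ _ h

/-- The map to `(E ⋔ G)(s)` with given components. -/
noncomputable def cotensorObjLift (G : Rᵒᵖ ⥤ Type v) {E A : M} (s : R)
    (y : G.obj (op s) → (A ⟶ E)) : A ⟶ (cotensor G E).obj s :=
  Pi.lift y

@[simp]
lemma cotensorObjLift_π (G : Rᵒᵖ ⥤ Type v) {E A : M} (s : R)
    (y : G.obj (op s) → (A ⟶ E)) (x : G.obj (op s)) :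
    cotensorObjLift G s y ≫ cotensorπ G E s x = y x :=
  Pi.lift_π _ _

lemma cotensor_map_π (G : Rᵒᵖ ⥤ Type v) (E : M) {s t : R} (k : s ⟶ t) (x : G.obj (op t)) :
    (cotensor G E).map k ≫ cotensorπ G E t x = cotensorπ G E s (G.map k.op x) :=
  (Pi.lift_π _ _).trans (Category.comp_id _)

lemma cotensor_map_app_π {G H : Rᵒᵖ ⥤ Type v} (κ : G ⟶ H) (E : M) (s : R) (x : G.obj (op s)) :
    (((cotensorFunctor R M).map κ.op).app E).app s ≫ cotensorπ G E s x =
      cotensorπ H E s (κ.app _ x) :=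
  (Pi.lift_π _ _).trans (Category.comp_id _)

lemma cotensor_map_app_π' (G : Rᵒᵖ ⥤ Type v) {E B : M} (p : E ⟶ B) (s : R) (x : G.obj (op s)) :
    (((cotensorFunctor R M).obj (op G)).map p).app s ≫ cotensorπ G B s x =
      cotensorπ G E s x ≫ p :=
  Pi.map_π (f := fun _ : G.obj (op s) ↦ E) (g := fun _ ↦ B) (fun _ ↦ p) x

/-- The natural transformation to `E ⋔ G` with given components. -/
noncomputable def cotensorLift {G : Rᵒᵖ ⥤ Type v} {E : M} {X : R ⥤ M}
    (y : ∀ s, G.obj (op s) → (X.obj s ⟶ E))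
    (hy : ∀ ⦃s t⦄ (k : s ⟶ t) (x : G.obj (op t)), y s (G.map k.op x) = X.map k ≫ y t x) :
    X ⟶ cotensor G E where
  app s := cotensorObjLift G s (y s)
  naturality s t k := cotensor_obj_hom_ext (fun x ↦ by
    rw [Category.assoc, cotensorObjLift_π, Category.assoc, cotensor_map_π, cotensorObjLift_π,
      hy])

@[simp]
lemma cotensorLift_app_π {G : Rᵒᵖ ⥤ Type v} {E : M} {X : R ⥤ M}
    (y : ∀ s, G.obj (op s) → (X.obj s ⟶ E)) (hy) (s : R) (x : G.obj (op s)) :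
    (cotensorLift y hy).app s ≫ cotensorπ G E s x = y s x :=
  cotensorObjLift_π _ _ _ _

lemma app_cotensorπ {G : Rᵒᵖ ⥤ Type v} {E : M} {X : R ⥤ M} (u : X ⟶ cotensor G E) {s t : R}
    (k : s ⟶ t) (x : G.obj (op t)) :
    u.app s ≫ cotensorπ G E s (G.map k.op x) = X.map k ≫ u.app t ≫ cotensorπ G E t x := by
  rw [← cotensor_map_π, u.naturality_assoc]

end

namespace ReedyStructure

variable {R : Type v} [SmallCategory R] {Rm Rp : MorphismProperty R}
  [Rm.IsMultiplicative] [Rp.IsMultiplicative] (ρ : ReedyStructure Rm Rp ℕ)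
  {M : Type u} [Category.{v} M] [HasLimits M]

section

variable {r : R}

/-- The projection `(E ⋔ R(-, r))(s) ⟶ E` corresponding to `f : s ⟶ r`. -/
noncomputable def yonedaπ (E : M) {s : R} (f : s ⟶ r) :
    (cotensor (yoneda.obj r) E).obj s ⟶ E :=
  cotensorπ (yoneda.obj r) E s f

/-- The projection `(E ⋔ ∂R(-, r))(s) ⟶ E` corresponding to `f : s ⟶ r`. -/
noncomputable def boundaryπ (E : M) {s : R} (f : s ⟶ r) (hf : ρ.degHom f < ρ.deg r) :
    (cotensor (ρ.boundary r).toFunctor E).obj s ⟶ E :=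
  cotensorπ (ρ.boundary r).toFunctor E s ⟨f, (ρ.mem_boundary_iff f).2 hf⟩

lemma hom_ext_yonedaπ {X : R ⥤ M} {E : M} {a b : X ⟶ cotensor (yoneda.obj r) E}
    (h : ∀ ⦃s⦄ (f : s ⟶ r), a.app s ≫ yonedaπ E f = b.app s ≫ yonedaπ E f) : a = b := by
  ext s
  exact cotensor_obj_hom_ext fun f ↦ h f

lemma hom_ext_boundaryπ {X : R ⥤ M} {E : M} {a b : X ⟶ cotensor (ρ.boundary r).toFunctor E}
    (h : ∀ ⦃s⦄ (f : s ⟶ r) hf, a.app s ≫ ρ.boundaryπ E f hf = b.app s ≫ ρ.boundaryπ E f hf) :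
    a = b := by
  ext s
  exact cotensor_obj_hom_ext fun f ↦ h f.1 ((ρ.mem_boundary_iff _).1 f.2)

lemma app_yonedaπ {X : R ⥤ M} {E : M} (a : X ⟶ cotensor (yoneda.obj r) E) {s : R} (f : s ⟶ r) :
    a.app s ≫ yonedaπ E f = X.map f ≫ a.app r ≫ yonedaπ E (𝟙 r) := by
  refine Eq.trans ?_ (app_cotensorπ a f (𝟙 r))
  congr 2
  exact (Category.comp_id f).symm

lemma app_comp_boundaryπ {X : R ⥤ M} {E : M} (a : X ⟶ cotensor (ρ.boundary r).toFunctor E)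
    {s t : R} (k : s ⟶ t) (f : t ⟶ r) (hf : ρ.degHom f < ρ.deg r)
    (hkf : ρ.degHom (k ≫ f) < ρ.deg r) :
    a.app s ≫ ρ.boundaryπ E (k ≫ f) hkf = X.map k ≫ a.app t ≫ ρ.boundaryπ E f hf :=
  app_cotensorπ a k ⟨f, (ρ.mem_boundary_iff f).2 hf⟩

lemma cotensor_ι_boundaryπ (E : M) {s : R} (f : s ⟶ r) (hf : ρ.degHom f < ρ.deg r) :
    (((cotensorFunctor R M).map (ρ.boundary r).ι.op).app E).app s ≫ ρ.boundaryπ E f hf =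
      yonedaπ E f :=
  cotensor_map_app_π _ _ _ _

lemma cotensor_map_yonedaπ {E B : M} (p : E ⟶ B) {s : R} (f : s ⟶ r) :
    (((cotensorFunctor R M).obj (op (yoneda.obj r))).map p).app s ≫ yonedaπ B f =
      yonedaπ E f ≫ p :=
  cotensor_map_app_π' _ _ _ _

lemma cotensor_map_boundaryπ {E B : M} (p : E ⟶ B) {s : R} (f : s ⟶ r)
    (hf : ρ.degHom f < ρ.deg r) :
    (((cotensorFunctor R M).obj (op (ρ.boundary r).toFunctor)).map p).app s ≫
      ρ.boundaryπ B f hf = ρ.boundaryπ E f hf ≫ p :=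
  cotensor_map_app_π' _ _ _ _

/-- The map `X ⟶ E ⋔ R(-, r)` corresponding to `X r ⟶ E`. -/
noncomputable def yonedaLift {X : R ⥤ M} {E : M} (e : X.obj r ⟶ E) :
    X ⟶ cotensor (yoneda.obj r) E :=
  cotensorLift (fun s (f : s ⟶ r) ↦ X.map f ≫ e) (fun s t k f ↦ by
    rw [← X.map_comp_assoc]; rfl)

@[simp]
lemma yonedaLift_app_π {X : R ⥤ M} {E : M} (e : X.obj r ⟶ E) {s : R} (f : s ⟶ r) :
    (yonedaLift e).app s ≫ yonedaπ E f = X.map f ≫ e :=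
  cotensorLift_app_π _ _ _ _

@[simp]
lemma yonedaLift_app_π_assoc {X : R ⥤ M} {E : M} (e : X.obj r ⟶ E) {s : R} (f : s ⟶ r) {Y : M}
    (h : _ ⟶ Y) :
    (yonedaLift e).app s ≫ yonedaπ E f ≫ h =
      X.map f ≫ e ≫ h := by
  rw [reassoc_of% yonedaLift_app_π]

/-- The map `X ⟶ E ⋔ ∂R(-, r)` with given components. -/
noncomputable def boundaryLift {X : R ⥤ M} {E : M}
    (l : ∀ ⦃s : R⦄ (f : s ⟶ r), ρ.degHom f < ρ.deg r → (X.obj s ⟶ E))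
    (hl : ∀ ⦃s t : R⦄ (k : s ⟶ t) (f : t ⟶ r) hf hkf, l (k ≫ f) hkf = X.map k ≫ l f hf) :
    X ⟶ cotensor (ρ.boundary r).toFunctor E :=
  cotensorLift (fun _ f ↦ l f.1 ((ρ.mem_boundary_iff _).1 f.2)) (fun _ _ k f ↦ hl k f.1 _ _)

@[simp]
lemma boundaryLift_app_π {X : R ⥤ M} {E : M}
    (l : ∀ ⦃s : R⦄ (f : s ⟶ r), ρ.degHom f < ρ.deg r → (X.obj s ⟶ E)) (hl) {s : R}
    (f : s ⟶ r) (hf : ρ.degHom f < ρ.deg r) :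
    (ρ.boundaryLift l hl).app s ≫ ρ.boundaryπ E f hf = l f hf :=
  cotensorLift_app_π _ _ _ _

@[simp]
lemma boundaryLift_app_π_assoc {X : R ⥤ M} {E : M}
    (l : ∀ ⦃s : R⦄ (f : s ⟶ r), ρ.degHom f < ρ.deg r → (X.obj s ⟶ E)) (hl) {s : R}
    (f : s ⟶ r) (hf : ρ.degHom f < ρ.deg r) {Y : M}
    (h : _ ⟶ Y) :
    (ρ.boundaryLift l hl).app s ≫ ρ.boundaryπ E f hf ≫ h =
      l f hf ≫ h := by
  rw [reassoc_of% boundaryLift_app_π]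

/-- It suffices to check an equality of natural families indexed by `∂R(-, r)` on
degree-raising maps. -/
lemma hom_ext_boundaryπ_of_prop {X : R ⥤ M} {E : M}
    {a b : X ⟶ cotensor (ρ.boundary r).toFunctor E}
    (h : ∀ ⦃s⦄ (f : s ⟶ r) (_ : Rp f) (_ : ρ.deg s < ρ.deg r) hf,
      a.app s ≫ ρ.boundaryπ E f hf = b.app s ≫ ρ.boundaryπ E f hf) : a = b := by
  refine ρ.hom_ext_boundaryπ fun s f hf ↦ ?_
  obtain ⟨t, k, c, hk, hc, rfl, hd⟩ := ρ.exists_fac f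
  have ht : ρ.deg t < ρ.deg r := by lia
  have hc' : ρ.degHom c < ρ.deg r := by rwa [ρ.degHom_eq_of_prop₂ c hc]
  rw [ρ.app_comp_boundaryπ a k c hc', ρ.app_comp_boundaryπ b k c hc', h c hc ht]

end

/-- The adjunction between relative latching maps and pullback-cotensors. -/
lemma hasLiftingProperty_pullbackCotensor_iff {Φ Ψ : R ⥤ M} (τ : Φ ⟶ Ψ) {E B : M} (p : E ⟶ B)
    (r : R) : HasLiftingProperty τ (ρ.pullbackCotensor p r) ↔ ρ.LatchLift τ r p := by
  let sq : (cotensorFunctor R M).PullbackObjObj (ρ.boundary r).ι p := .ofHasPullback _ _ _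
  change HasLiftingProperty τ sq.π ↔ _
  have app_fst {X : R ⥤ M} (v : X ⟶ cotensor (yoneda.obj r) E) {s : R} (f : s ⟶ r)
      (hf : ρ.degHom f < ρ.deg r) :
      (v ≫ sq.π ≫ sq.fst).app s ≫ ρ.boundaryπ E f hf = v.app s ≫ yonedaπ E f := by
    rw [sq.π_fst, NatTrans.comp_app, Category.assoc, cotensor_ι_boundaryπ]
  have app_snd {X : R ⥤ M} (v : X ⟶ cotensor (yoneda.obj r) E) {s : R} (f : s ⟶ r) :
      (v ≫ sq.π ≫ sq.snd).app s ≫ yonedaπ B f = v.app s ≫ yonedaπ E f ≫ p := by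
    rw [sq.π_snd, NatTrans.comp_app, Category.assoc, cotensor_map_yonedaπ]
  have deg_lt {s : R} {f : s ⟶ r} (hf : Rp f) (hs : ρ.deg s < ρ.deg r) :
      ρ.degHom f < ρ.deg r := by
    rwa [ρ.degHom_eq_of_prop₂ f hf]
  constructor
  · intro _ e l b h₁ h₂ h₃
    -- A map to E ⋔ ∂R(-, r) needs values on the whole boundary; the latching family gives them only
    -- on raising maps.
    obtain ⟨l', hl, hl'⟩ := l.exists_extension
    have hw : ρ.boundaryLift l' hl' ≫
        ((cotensorFunctor R M).obj (op (ρ.boundary r).toFunctor)).map p =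
          yonedaLift b ≫ ((cotensorFunctor R M).map (ρ.boundary r).ι.op).app B :=
      ρ.hom_ext_boundaryπ_of_prop fun s f hf hs hf' ↦ by
        rw [NatTrans.comp_app, NatTrans.comp_app, Category.assoc, Category.assoc,
          cotensor_ι_boundaryπ, cotensor_map_boundaryπ, boundaryLift_app_π_assoc,
          yonedaLift_app_π, hl f hf hs, h₃]
    have hsq : CommSq (yonedaLift e) τ sq.π (sq.isPullback.lift _ _ hw) := ⟨by
      apply sq.hom_ext
      · refine ρ.hom_ext_boundaryπ_of_prop fun s f hf hs hf' ↦ ?_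
        rw [Category.assoc, app_fst, Category.assoc, sq.isPullback.lift_fst, NatTrans.comp_app,
          Category.assoc, boundaryLift_app_π, yonedaLift_app_π, hl f hf hs, h₁]
      · refine hom_ext_yonedaπ fun s f ↦ ?_
        rw [Category.assoc, app_snd, Category.assoc, sq.isPullback.lift_snd, NatTrans.comp_app,
          Category.assoc, yonedaLift_app_π_assoc, yonedaLift_app_π, h₂, τ.naturality_assoc]⟩
    obtain ⟨k, hk₁, hk₂⟩ : ∃ k, τ ≫ k = yonedaLift e ∧ k ≫ sq.π = sq.isPullback.lift _ _ hw :=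
      ⟨hsq.lift, hsq.fac_left, hsq.fac_right⟩
    -- Yoneda: a map to E ⋔ R(-, r) is determined by its component at the identity of r.
    refine ⟨k.app r ≫ yonedaπ E (𝟙 r), ?_, fun s f hf hs ↦ ?_, ?_⟩
    · rw [← NatTrans.comp_app_assoc, hk₁, yonedaLift_app_π, Φ.map_id, Category.id_comp]
    · rw [← app_yonedaπ, ← app_fst k f (deg_lt hf hs), reassoc_of% hk₂, sq.isPullback.lift_fst,
        boundaryLift_app_π, hl f hf hs]
    · rw [Category.assoc, ← app_snd, reassoc_of% hk₂, sq.isPullback.lift_snd, yonedaLift_app_π,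
        Ψ.map_id, Category.id_comp]
  · intro H
    refine ⟨fun {u v} hsq ↦ ?_⟩
    have w₁ : u ≫ sq.π ≫ sq.fst = τ ≫ v ≫ sq.fst := by
      rw [← Category.assoc, hsq.w, Category.assoc]
    have w₂ : u ≫ sq.π ≫ sq.snd = τ ≫ v ≫ sq.snd := by
      rw [← Category.assoc, hsq.w, Category.assoc]
    have w₃ : (v ≫ sq.fst) ≫ ((cotensorFunctor R M).obj (op (ρ.boundary r).toFunctor)).map p =
        (v ≫ sq.snd) ≫ ((cotensorFunctor R M).map (ρ.boundary r).ι.op).app B := by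
      rw [Category.assoc, Category.assoc, sq.isPullback.w]
    obtain ⟨h, h₁, h₂, h₃⟩ := H (u.app r ≫ yonedaπ E (𝟙 r))
      { app {s} f hf hs := (v ≫ sq.fst).app s ≫ ρ.boundaryπ E f (deg_lt hf hs)
        map_app k f hk hf hs ht := (ρ.app_comp_boundaryπ _ k f _ _).symm }
      ((v ≫ sq.snd).app r ≫ yonedaπ B (𝟙 r))
      (fun s f hf hs ↦ by
        rw [← app_yonedaπ, ← app_fst u f (deg_lt hf hs), w₁, NatTrans.comp_app, Category.assoc])
      (by rw [Category.assoc, ← app_snd, w₂, NatTrans.comp_app, Category.assoc])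
      (fun s f hf hs ↦ by
        rw [← app_yonedaπ, Category.assoc, ← cotensor_map_boundaryπ, ← NatTrans.comp_app_assoc,
          w₃, NatTrans.comp_app, Category.assoc, cotensor_ι_boundaryπ])
    refine ⟨⟨yonedaLift h, ?_, ?_⟩⟩
    · refine hom_ext_yonedaπ fun s f ↦ ?_
      rw [app_yonedaπ u, NatTrans.comp_app, Category.assoc, ← h₁, yonedaLift_app_π,
        τ.naturality_assoc]
    · apply sq.hom_ext
      · refine ρ.hom_ext_boundaryπ_of_prop fun s f hf hs hf' ↦ ?_
        rw [Category.assoc, app_fst, yonedaLift_app_π, h₂ f hf hs]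
      · refine hom_ext_yonedaπ fun s f ↦ ?_
        rw [app_yonedaπ (v ≫ sq.snd), Category.assoc, app_snd, ← h₃, yonedaLift_app_π_assoc]

lemma llp_pullbackCotensorClass_iff (X : MorphismProperty M) {Φ Ψ : R ⥤ M} (τ : Φ ⟶ Ψ) :
    (ρ.pullbackCotensorClass X).llp τ ↔
      ∀ (r : R) ⦃E B : M⦄ (p : E ⟶ B), X p → ρ.LatchLift τ r p := by
  constructor
  · intro h r E B p hp
    rw [← ρ.hasLiftingProperty_pullbackCotensor_iff]
    exact h _ (.mk p hp r)
  · rintro h _ _ _ ⟨p, hp, r⟩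
    rw [ρ.hasLiftingProperty_pullbackCotensor_iff]
    exact h r p hp

/-- This is where fibrant generation passes from M to diagrams: the adjunction is applied to each p
in X and each r. -/
lemma llp_pullbackCotensorClass_iff_relativeLatchingMap [HasColimits M] (X : MorphismProperty M)
    {Φ Ψ : R ⥤ M} (τ : Φ ⟶ Ψ) :
    (ρ.pullbackCotensorClass X).llp τ ↔ ∀ r, X.llp (ρ.relativeLatchingMap r τ) := by
  rw [llp_pullbackCotensorClass_iff]
  exact forall_congr' fun r ↦ ⟨fun h _ _ p hp ↦
    (ρ.hasLiftingProperty_relativeLatchingMap_iff τ p).2 (h p hp), fun h _ _ p hp ↦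
    (ρ.hasLiftingProperty_relativeLatchingMap_iff τ p).1 (h p hp)⟩

end ReedyStructure

end HomotopicalAlgebra

/-! ### Attaching cells in one degree -/

namespace HomotopicalAlgebra

section

variable {R : Type v} [SmallCategory R] {M : Type u} [Category.{v} M] [HasColimits M]
  {J : Type v} (b : J → R) (A : J → M) (P : ∀ (j : J) ⦃s : R⦄, (b j ⟶ s) → Prop)

omit [HasColimits M] in
lemma sigma_ι_congr {s : R} {j : J} {g g' : b j ⟶ s} (e : g = g') (hg : P j g) (hg' : P j g')
    [HasCoproduct fun x : { x : Σ j, (b j ⟶ s) // P x.1 x.2 } ↦ A x.1.1] :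
    (Sigma.ι (fun x : { x : Σ j, (b j ⟶ s) // P x.1 x.2 } ↦ A x.1.1) ⟨⟨j, g⟩, hg⟩ :
      A j ⟶ _) =
    Sigma.ι (fun x : { x : Σ j, (b j ⟶ s) // P x.1 x.2 } ↦ A x.1.1) ⟨⟨j, g'⟩, hg'⟩ := by
  subst e
  rfl

/-- The coproduct of the tensors `A j ⊗ P j`, where `P j` is a family of subsets of the
representable functors `R(b j, -)`, which are assumed to be stable under postcomposition. -/
noncomputable def sigmaTensor
    (hP : ∀ (j : J) ⦃s t : R⦄ (g : b j ⟶ s) (k : s ⟶ t), P j g → P j (g ≫ k)) : R ⥤ M where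
  obj s := ∐ fun x : { x : Σ j, (b j ⟶ s) // P x.1 x.2 } ↦ A x.1.1
  map {s t} k := Sigma.desc fun x ↦
    Sigma.ι (fun x : { x : Σ j, (b j ⟶ t) // P x.1 x.2 } ↦ A x.1.1)
      ⟨⟨x.1.1, x.1.2 ≫ k⟩, hP _ _ _ x.2⟩
  map_id s := by
    refine Sigma.hom_ext _ _ fun x ↦ ?_
    rw [Category.comp_id]
    exact (Sigma.ι_desc _ _).trans (sigma_ι_congr b A P (Category.comp_id _) _ _)
  map_comp {s t t'} k k' := by
    refine Sigma.hom_ext _ _ fun x ↦ ?_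
    refine (Sigma.ι_desc _ _).trans ((sigma_ι_congr b A P (Category.assoc _ _ _).symm _
      (hP _ _ _ (hP _ _ _ x.2))).trans ?_)
    symm
    refine (Category.assoc _ _ _).symm.trans ?_
    rw [Sigma.ι_desc]
    exact Sigma.ι_desc _ _

variable {b P} (hP : ∀ (j : J) ⦃s t : R⦄ (g : b j ⟶ s) (k : s ⟶ t), P j g → P j (g ≫ k))

/-- The inclusions `A j ⟶ (∐ A j ⊗ P j)(s)`. -/
noncomputable def sigmaTensorι (j : J) {s : R} (g : b j ⟶ s) (hg : P j g) :
    A j ⟶ (sigmaTensor b A P hP).obj s :=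
  Sigma.ι (fun x : { x : Σ j, (b j ⟶ s) // P x.1 x.2 } ↦ A x.1.1) ⟨⟨j, g⟩, hg⟩

lemma sigmaTensorι_map (j : J) {s t : R} (g : b j ⟶ s) (hg : P j g) (k : s ⟶ t) :
    sigmaTensorι A hP j g hg ≫ (sigmaTensor b A P hP).map k =
      sigmaTensorι A hP j (g ≫ k) (hP _ _ _ hg) :=
  Sigma.ι_desc _ _

lemma sigmaTensorι_map_assoc (j : J) {s t : R} (g : b j ⟶ s) (hg : P j g) (k : s ⟶ t) {Y : M}
    (h : _ ⟶ Y) :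
    sigmaTensorι A hP j g hg ≫ (sigmaTensor b A P hP).map k ≫ h =
      sigmaTensorι A hP j (g ≫ k) (hP _ _ _ hg) ≫ h := by
  rw [reassoc_of% sigmaTensorι_map]

variable {A hP}

lemma sigmaTensor_obj_hom_ext {s : R} {T : M} {a b : (sigmaTensor b A P hP).obj s ⟶ T}
    (h : ∀ j g hg, sigmaTensorι A hP j g hg ≫ a = sigmaTensorι A hP j g hg ≫ b) : a = b :=
  Sigma.hom_ext _ _ fun x ↦ h x.1.1 x.1.2 x.2

/-- The map from `(∐ A j ⊗ P j)(s)` with given components. -/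
noncomputable def sigmaTensorObjDesc {s : R} {T : M}
    (y : ∀ (j : J) (g : b j ⟶ s), P j g → (A j ⟶ T)) : (sigmaTensor b A P hP).obj s ⟶ T :=
  Sigma.desc fun x ↦ y x.1.1 x.1.2 x.2

@[simp]
lemma sigmaTensorι_objDesc {s : R} {T : M} (y : ∀ (j : J) (g : b j ⟶ s), P j g → (A j ⟶ T))
    (j : J) (g : b j ⟶ s) (hg : P j g) :
    sigmaTensorι A hP j g hg ≫ sigmaTensorObjDesc y = y j g hg :=
  Sigma.ι_desc _ _

@[simp]
lemma sigmaTensorι_objDesc_assoc {s : R} {T : M} (y : ∀ (j : J) (g : b j ⟶ s), P j g → (A j ⟶ T))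
    (j : J) (g : b j ⟶ s) (hg : P j g) {Y : M}
    (h : _ ⟶ Y) :
    sigmaTensorι A hP j g hg ≫ sigmaTensorObjDesc y ≫ h =
      y j g hg ≫ h := by
  rw [reassoc_of% sigmaTensorι_objDesc]

/-- The natural transformation from `∐ A j ⊗ P j` with given components. -/
noncomputable def sigmaTensorDesc {X : R ⥤ M}
    (y : ∀ (j : J) ⦃s : R⦄ (g : b j ⟶ s), P j g → (A j ⟶ X.obj s))
    (hy : ∀ (j : J) ⦃s t : R⦄ (g : b j ⟶ s) (k : s ⟶ t) hg hgk,
      y j (g ≫ k) hgk = y j g hg ≫ X.map k) :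
    sigmaTensor b A P hP ⟶ X where
  app s := sigmaTensorObjDesc fun j g hg ↦ y j g hg
  naturality s t k := sigmaTensor_obj_hom_ext fun j g hg ↦ by
    rw [sigmaTensorι_map_assoc, sigmaTensorι_objDesc, sigmaTensorι_objDesc_assoc, hy]

@[simp]
lemma sigmaTensorι_desc_app {X : R ⥤ M}
    (y : ∀ (j : J) ⦃s : R⦄ (g : b j ⟶ s), P j g → (A j ⟶ X.obj s)) (hy)
    (j : J) {s : R} (g : b j ⟶ s) (hg : P j g) :
    sigmaTensorι A hP j g hg ≫ (sigmaTensorDesc y hy).app s = y j g hg :=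
  sigmaTensorι_objDesc (hP := hP) (fun j (g : b j ⟶ s) hg ↦ y j g hg) j g hg

end

namespace ReedyStructure

variable {R : Type v} [SmallCategory R] {Rm Rp : MorphismProperty R}
  [Rm.IsMultiplicative] [Rp.IsMultiplicative] (ρ : ReedyStructure Rm Rp ℕ)
  {M : Type u} [Category.{v} M]

/-- The data needed in order to attach to a functor `E` cells of dimension `n`: for any object `j`
of degree `n`, this is a map `E j ⟶ F j`, and an extension to `F j` of the maps
`E g : E j ⟶ E s` for `g` in the boundary of `R(j, -)`. -/
structure AttachingData (E : R ⥤ M) (n : ℕ) where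
  /-- the new objects in degree `n` -/
  F (j : { r : R // ρ.deg r = n }) : M
  /-- the map from the old objects to the new objects -/
  i (j : { r : R // ρ.deg r = n }) : E.obj j.1 ⟶ F j
  /-- the map from the new objects to the matching objects -/
  m (j : { r : R // ρ.deg r = n }) ⦃s : R⦄ (g : j.1 ⟶ s) (hg : ρ.degHom g < n) : F j ⟶ E.obj s
  m_comp (j : { r : R // ρ.deg r = n }) ⦃s t : R⦄ (g : j.1 ⟶ s) (k : s ⟶ t)
    (hg : ρ.degHom g < n) (hgk : ρ.degHom (g ≫ k) < n) : m j (g ≫ k) hgk = m j g hg ≫ E.map k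
  i_m (j : { r : R // ρ.deg r = n }) ⦃s : R⦄ (g : j.1 ⟶ s) (hg : ρ.degHom g < n) :
    i j ≫ m j g hg = E.map g

namespace AttachingData

variable {ρ} {E : R ⥤ M} {n : ℕ} (d : ρ.AttachingData E n) [HasColimits M]

/-- The cells to be attached. -/
noncomputable def cells : R ⥤ M :=
  sigmaTensor Subtype.val d.F (fun _ _ _ ↦ True) (fun _ _ _ _ _ _ ↦ trivial)

/-- The inclusions in the cells. -/
noncomputable def cellsι (j : { r : R // ρ.deg r = n }) {s : R} (g : j.1 ⟶ s) :
    d.F j ⟶ d.cells.obj s :=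
  sigmaTensorι d.F (P := fun _ _ _ ↦ True) (fun _ _ _ _ _ _ ↦ trivial) j g trivial

lemma cellsι_map (j : { r : R // ρ.deg r = n }) {s t : R} (g : j.1 ⟶ s) (k : s ⟶ t) :
    d.cellsι j g ≫ d.cells.map k = d.cellsι j (g ≫ k) :=
  sigmaTensorι_map _ _ _ _ _ _

lemma cellsι_map_assoc (j : { r : R // ρ.deg r = n }) {s t : R} (g : j.1 ⟶ s) (k : s ⟶ t) {Y : M}
    (h : _ ⟶ Y) :
    d.cellsι j g ≫ d.cells.map k ≫ h =
      d.cellsι j (g ≫ k) ≫ h := by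
  rw [reassoc_of% cellsι_map]

/-- The objects appearing in the boundary of the cells. -/
def boundaryObj : { r : R // ρ.deg r = n } × Bool → M
  | ⟨j, true⟩ => E.obj j.1
  | ⟨j, false⟩ => d.F j

lemma boundary_stable (j : { r : R // ρ.deg r = n } × Bool) ⦃s t : R⦄ (g : j.1.1 ⟶ s)
    (k : s ⟶ t) (hg : j.2 = true ∨ ρ.degHom g < n) : j.2 = true ∨ ρ.degHom (g ≫ k) < n :=
  hg.imp_right (ρ.degHom_comp_le_left g k).trans_lt

/-- The boundary of the cells, or rather its cover by two pieces. -/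
noncomputable def cellsBoundary : R ⥤ M :=
  -- The coproduct of E j ⊗ R(j, -) and F j ⊗ ∂R(j, -) covers their union over E j ⊗ ∂R(j, -). By
  -- `i_m` both the attaching map and the inclusion factor through that union, so gluing along the
  -- cover gives the same pushout.
  sigmaTensor (fun j ↦ j.1.1) d.boundaryObj (fun j _ g ↦ j.2 = true ∨ ρ.degHom g < n)
    boundary_stable

/-- The attaching map. -/
noncomputable def attach : d.cellsBoundary ⟶ E :=
  sigmaTensorDesc
    (fun
      | ⟨_, true⟩, _, g, _ => E.map g
      | ⟨j, false⟩, _, g, hg => d.m j g (hg.resolve_left (by simp)))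
    (fun
      | ⟨_, true⟩, _, _, g, k, _, _ => E.map_comp g k
      | ⟨j, false⟩, _, _, g, k, _, _ => d.m_comp j g k _ _)

/-- The inclusion of the boundary of the cells. -/
noncomputable def boundaryι : d.cellsBoundary ⟶ d.cells :=
  sigmaTensorDesc
    (fun
      | ⟨j, true⟩, _, g, _ => d.i j ≫ d.cellsι j g
      | ⟨j, false⟩, _, g, _ => d.cellsι j g)
    (fun
      | ⟨j, true⟩, _, _, g, k, _, _ => by
        change d.i j ≫ d.cellsι j (g ≫ k) = (d.i j ≫ d.cellsι j g) ≫ d.cells.map k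
        rw [Category.assoc, cellsι_map]
      | ⟨j, false⟩, _, _, g, k, _, _ => (d.cellsι_map j g k).symm)

/-- The inclusions in the first part of the boundary. -/
noncomputable def boundaryι₁ (j : { r : R // ρ.deg r = n }) {s : R} (g : j.1 ⟶ s) :
    E.obj j.1 ⟶ d.cellsBoundary.obj s :=
  sigmaTensorι d.boundaryObj boundary_stable ⟨j, true⟩ g (Or.inl rfl)

/-- The inclusions in the second part of the boundary. -/
noncomputable def boundaryι₂ (j : { r : R // ρ.deg r = n }) {s : R} (g : j.1 ⟶ s)
    (hg : ρ.degHom g < n) : d.F j ⟶ d.cellsBoundary.obj s :=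
  sigmaTensorι d.boundaryObj boundary_stable ⟨j, false⟩ g (Or.inr hg)

lemma cellsBoundary_hom_ext {s : R} {T : M} {a b : d.cellsBoundary.obj s ⟶ T}
    (h₁ : ∀ j (g : j.1 ⟶ s), d.boundaryι₁ j g ≫ a = d.boundaryι₁ j g ≫ b)
    (h₂ : ∀ j (g : j.1 ⟶ s) hg, d.boundaryι₂ j g hg ≫ a = d.boundaryι₂ j g hg ≫ b) : a = b :=
  sigmaTensor_obj_hom_ext (fun
    | ⟨j, true⟩, g, _ => h₁ j g
    | ⟨j, false⟩, g, hg => h₂ j g (hg.resolve_left (by simp)))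

lemma boundaryι₁_attach (j : { r : R // ρ.deg r = n }) {s : R} (g : j.1 ⟶ s) :
    d.boundaryι₁ j g ≫ d.attach.app s = E.map g :=
  sigmaTensorι_desc_app _ _ _ _ _

lemma boundaryι₁_attach_assoc (j : { r : R // ρ.deg r = n }) {s : R} (g : j.1 ⟶ s) {Y : M}
    (h : _ ⟶ Y) :
    d.boundaryι₁ j g ≫ d.attach.app s ≫ h =
      E.map g ≫ h := by
  rw [reassoc_of% boundaryι₁_attach]

lemma boundaryι₂_attach (j : { r : R // ρ.deg r = n }) {s : R} (g : j.1 ⟶ s)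
    (hg : ρ.degHom g < n) : d.boundaryι₂ j g hg ≫ d.attach.app s = d.m j g hg :=
  sigmaTensorι_desc_app _ _ _ _ _

lemma boundaryι₂_attach_assoc (j : { r : R // ρ.deg r = n }) {s : R} (g : j.1 ⟶ s)
    (hg : ρ.degHom g < n) {Y : M}
    (h : _ ⟶ Y) :
    d.boundaryι₂ j g hg ≫ d.attach.app s ≫ h =
      d.m j g hg ≫ h := by
  rw [reassoc_of% boundaryι₂_attach]

lemma boundaryι₁_boundaryι (j : { r : R // ρ.deg r = n }) {s : R} (g : j.1 ⟶ s) :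
    d.boundaryι₁ j g ≫ d.boundaryι.app s = d.i j ≫ d.cellsι j g :=
  sigmaTensorι_desc_app _ _ _ _ _

lemma boundaryι₁_boundaryι_assoc (j : { r : R // ρ.deg r = n }) {s : R} (g : j.1 ⟶ s) {Y : M}
    (h : _ ⟶ Y) :
    d.boundaryι₁ j g ≫ d.boundaryι.app s ≫ h =
      d.i j ≫ d.cellsι j g ≫ h := by
  rw [reassoc_of% boundaryι₁_boundaryι]

lemma boundaryι₂_boundaryι (j : { r : R // ρ.deg r = n }) {s : R} (g : j.1 ⟶ s)
    (hg : ρ.degHom g < n) : d.boundaryι₂ j g hg ≫ d.boundaryι.app s = d.cellsι j g :=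
  sigmaTensorι_desc_app _ _ _ _ _

lemma boundaryι₂_boundaryι_assoc (j : { r : R // ρ.deg r = n }) {s : R} (g : j.1 ⟶ s)
    (hg : ρ.degHom g < n) {Y : M}
    (h : _ ⟶ Y) :
    d.boundaryι₂ j g hg ≫ d.boundaryι.app s ≫ h =
      d.cellsι j g ≫ h := by
  rw [reassoc_of% boundaryι₂_boundaryι]

/-- The functor obtained by attaching the cells. -/
noncomputable def obj : R ⥤ M := pushout d.attach d.boundaryι

/-- The inclusion in the functor obtained by attaching the cells. -/
noncomputable def inl : E ⟶ d.obj := pushout.inl _ _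

/-- The map from the cells to the functor obtained by attaching them. -/
noncomputable def inr : d.cells ⟶ d.obj := pushout.inr _ _

lemma isPushout_app (s : R) : IsPushout (d.attach.app s) (d.boundaryι.app s)
    (d.inl.app s) (d.inr.app s) :=
  (IsPushout.of_hasPushout d.attach d.boundaryι).map ((evaluation R M).obj s)

/-- The maps from the new objects to the functor obtained by attaching the cells. -/
noncomputable def cell (j : { r : R // ρ.deg r = n }) {s : R} (g : j.1 ⟶ s) :
    d.F j ⟶ d.obj.obj s :=
  d.cellsι j g ≫ d.inr.app s

lemma cell_map (j : { r : R // ρ.deg r = n }) {s t : R} (g : j.1 ⟶ s) (k : s ⟶ t) :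
    d.cell j g ≫ d.obj.map k = d.cell j (g ≫ k) := by
  rw [cell, cell, Category.assoc, ← d.inr.naturality, cellsι_map_assoc]

lemma cell_map_assoc (j : { r : R // ρ.deg r = n }) {s t : R} (g : j.1 ⟶ s) (k : s ⟶ t) {Y : M}
    (h : _ ⟶ Y) :
    d.cell j g ≫ d.obj.map k ≫ h =
      d.cell j (g ≫ k) ≫ h := by
  rw [reassoc_of% cell_map]

lemma i_cell (j : { r : R // ρ.deg r = n }) {s : R} (g : j.1 ⟶ s) :
    d.i j ≫ d.cell j g = E.map g ≫ d.inl.app s := by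
  rw [cell, ← d.boundaryι₁_boundaryι_assoc, ← (d.isPushout_app s).w, boundaryι₁_attach_assoc]

lemma i_cell_assoc (j : { r : R // ρ.deg r = n }) {s : R} (g : j.1 ⟶ s) {Y : M}
    (h : _ ⟶ Y) :
    d.i j ≫ d.cell j g ≫ h =
      E.map g ≫ d.inl.app s ≫ h := by
  rw [reassoc_of% i_cell]

lemma cell_of_lt (j : { r : R // ρ.deg r = n }) {s : R} (g : j.1 ⟶ s) (hg : ρ.degHom g < n) :
    d.cell j g = d.m j g hg ≫ d.inl.app s := by
  rw [cell, ← d.boundaryι₂_boundaryι_assoc j g hg, ← (d.isPushout_app s).w,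
    boundaryι₂_attach_assoc]

lemma hom_ext {s : R} {T : M} {a b : d.obj.obj s ⟶ T} (h : d.inl.app s ≫ a = d.inl.app s ≫ b)
    (h' : ∀ j (g : j.1 ⟶ s), d.cell j g ≫ a = d.cell j g ≫ b) : a = b := by
  apply (d.isPushout_app s).hom_ext h
  refine sigmaTensor_obj_hom_ext fun j g _ ↦ ?_
  have := h' j g
  rw [cell, Category.assoc, Category.assoc] at this
  exact this

lemma exists_desc {s : R} {T : M} (x : E.obj s ⟶ T)
    (y : ∀ j : { r : R // ρ.deg r = n }, (j.1 ⟶ s) → (d.F j ⟶ T))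
    (h₁ : ∀ j g, d.i j ≫ y j g = E.map g ≫ x)
    (h₂ : ∀ j g hg, y j g = d.m j g hg ≫ x) :
    ∃ h : d.obj.obj s ⟶ T, d.inl.app s ≫ h = x ∧ ∀ j g, d.cell j g ≫ h = y j g := by
  obtain ⟨z, hz⟩ : ∃ z : d.cells.obj s ⟶ T, ∀ j g, d.cellsι j g ≫ z = y j g :=
    ⟨sigmaTensorObjDesc (fun j g _ ↦ y j g), fun j g ↦ sigmaTensorι_objDesc _ _ _ _⟩
  have w : d.attach.app s ≫ x = d.boundaryι.app s ≫ z :=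
    d.cellsBoundary_hom_ext
      (fun j g ↦ by rw [boundaryι₁_attach_assoc, boundaryι₁_boundaryι_assoc, hz, h₁])
      (fun j g hg ↦ by
        rw [boundaryι₂_attach_assoc, boundaryι₂_boundaryι_assoc, hz, h₂ j g hg])
  refine ⟨(d.isPushout_app s).desc x z w, (d.isPushout_app s).inl_desc _ _ _, fun j g ↦ ?_⟩
  rw [cell, Category.assoc, (d.isPushout_app s).inr_desc, hz]

lemma exists_desc_natTrans {Ψ : R ⥤ M} (π : E ⟶ Ψ)
    (q : ∀ j : { r : R // ρ.deg r = n }, d.F j ⟶ Ψ.obj j.1)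
    (h₁ : ∀ j, d.i j ≫ q j = π.app j.1)
    (h₂ : ∀ j ⦃s⦄ (g : j.1 ⟶ s) hg, d.m j g hg ≫ π.app s = q j ≫ Ψ.map g) :
    ∃ π' : d.obj ⟶ Ψ, d.inl ≫ π' = π ∧ ∀ j, d.cell j (𝟙 _) ≫ π'.app j.1 = q j := by
  have H (s : R) := d.exists_desc (π.app s) (fun j g ↦ q j ≫ Ψ.map g)
    (fun j g ↦ by rw [reassoc_of% h₁, π.naturality]) (fun j g hg ↦ (h₂ j g hg).symm)
  choose f hf hf' using H
  refine ⟨{ app := f, naturality := fun s t k ↦ ?_ }, ?_, fun j ↦ ?_⟩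
  · apply d.hom_ext
    · rw [← d.inl.naturality_assoc, hf, reassoc_of% hf, π.naturality]
    · intro j g
      rw [cell_map_assoc, hf', reassoc_of% hf' s j g, Ψ.map_comp]
  · ext s
    exact hf s
  · simp [hf']

/-- Every map from an object of degree n to s lies in the boundary when deg s < n, so all cells at s
are already attached to E. -/
lemma isIso_inl_app {s : R} (hs : ρ.deg s < n) : IsIso (d.inl.app s) := by
  have hlt {j : { r : R // ρ.deg r = n }} (g : j.1 ⟶ s) : ρ.degHom g < n :=
    (ρ.degHom_le_deg_right g).trans_lt hs
  obtain ⟨h, h₁, h₂⟩ := d.exists_desc (𝟙 (E.obj s)) (fun j g ↦ d.m j g (hlt g))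
    (fun j g ↦ by rw [d.i_m, Category.comp_id]) (fun j g hg ↦ by rw [Category.comp_id])
  refine ⟨h, h₁, d.hom_ext (by simp [reassoc_of% h₁]) fun j g ↦ ?_⟩
  rw [reassoc_of% h₂, Category.comp_id, d.cell_of_lt j g (hlt g)]

/-- At an object j of degree n, a map to j from another object of degree n lies in the boundary, and
so does every map j → j except the identity. The only new piece is thus F j. The inverse is `d.i j`
on E j, the identity on the cell at the identity, and `d.m k g ≫ d.i j` on boundary cells. -/
lemma isIso_cell_id (j : { r : R // ρ.deg r = n }) : IsIso (d.cell j (𝟙 j.1)) := by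
  have key (k : { r : R // ρ.deg r = n }) (g : k.1 ⟶ j.1) : ∃ y : d.F k ⟶ d.F j,
      d.i k ≫ y = E.map g ≫ d.i j ∧ (∀ hg, y = d.m k g hg ≫ d.i j) ∧
      y ≫ d.cell j (𝟙 j.1) = d.cell k g ∧ ∀ h : k = j, g = eqToHom (by rw [h]) →
        y = eqToHom (by rw [h]) := by
    by_cases hg : ρ.degHom g < n
    · refine ⟨d.m k g hg ≫ d.i j, by rw [← Category.assoc, d.i_m], fun _ ↦ rfl, ?_, ?_⟩
      · rw [Category.assoc, d.i_cell, d.cell_of_lt k g hg]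
        simp
      · rintro rfl rfl
        simp only [eqToHom_refl, degHom_id] at hg
        exact absurd hg (by simp [k.2])
    · obtain ⟨k, hk⟩ := k
      obtain ⟨j, rfl⟩ := j
      dsimp at g
      obtain ⟨rfl, rfl⟩ | hlt :=
        ρ.eq_id_or_lt g (ρ.prop₂_of_not_degHom_lt g (by rwa [hk]))
      · exact ⟨𝟙 _, by simp, fun h ↦ absurd h hg, by simp, fun _ _ ↦ rfl⟩
      · exact absurd hlt (by lia)
  choose y hy₁ hy₂ hy₃ hy₄ using key
  obtain ⟨h, h₁, h₂⟩ := d.exists_desc (d.i j) y hy₁ hy₂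
  refine ⟨h, ?_, d.hom_ext ?_ fun k g ↦ ?_⟩
  · rw [h₂, hy₄ j (𝟙 _) rfl rfl]
    simp
  · rw [reassoc_of% h₁, d.i_cell]
    simp
  · rw [reassoc_of% h₂, hy₃, Category.comp_id]

/-- The relative latching map of the inclusion is invertible away from degree n and a pushout of
`d.i` in degree n. Concretely, the lift is forced by e on boundary cells and by the latching family
on strictly raising cells. Only the identity cell at s requires a lift of `d.i` against p. -/
lemma latchLift_inl (s : R) {T B : M} (p : T ⟶ B) (hp : ∀ j, HasLiftingProperty (d.i j) p) :
    ρ.LatchLift d.inl s p := by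
  intro e l b h₁ h₂ h₃
  have key (j : { r : R // ρ.deg r = n }) (g : j.1 ⟶ s) : ∃ y : d.F j ⟶ T,
      d.i j ≫ y = E.map g ≫ e ∧ (∀ hg, y = d.m j g hg ≫ e) ∧
      (∀ hg (hlt : ρ.deg j.1 < ρ.deg s), ¬ ρ.degHom g < n →
        y = d.cell j (𝟙 _) ≫ l.app g hg hlt) ∧
      y ≫ p = d.cell j g ≫ b := by
    by_cases hg : ρ.degHom g < n
    · refine ⟨d.m j g hg ≫ e, by rw [← Category.assoc, d.i_m], fun _ ↦ rfl,
        fun _ _ h ↦ absurd hg h, ?_⟩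
      rw [d.cell_of_lt j g hg, Category.assoc, Category.assoc, h₂]
    · have hg' : Rp g := ρ.prop₂_of_not_degHom_lt g (by rwa [j.2])
      by_cases hlt : ρ.deg j.1 < ρ.deg s
      · refine ⟨d.cell j (𝟙 _) ≫ l.app g hg' hlt, ?_, fun h ↦ absurd h hg, fun _ _ _ ↦ rfl, ?_⟩
        · rw [d.i_cell_assoc, E.map_id, Category.id_comp, h₁]
        · rw [Category.assoc, h₃, d.cell_map_assoc, Category.id_comp]
      · obtain ⟨j, hj⟩ := j
        obtain ⟨h, hh⟩ | hlt' := ρ.eq_id_or_lt g hg'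
        · dsimp at h
          subst h
          obtain rfl : g = 𝟙 _ := hh
          have := hp ⟨_, hj⟩
          have sq : CommSq e (d.i ⟨_, hj⟩) p (d.cell ⟨_, hj⟩ (𝟙 _) ≫ b) := ⟨by
            rw [d.i_cell_assoc, E.map_id, Category.id_comp, h₂]⟩
          exact ⟨sq.lift, by simp, fun h ↦ absurd h hg, fun _ h ↦ absurd h hlt, sq.fac_right⟩
        · exact absurd hlt' hlt
  choose y hy₁ hy₂ hy₃ hy₄ using key
  obtain ⟨h, hh, hh'⟩ := d.exists_desc e y hy₁ hy₂
  refine ⟨h, hh, fun t f hf ht ↦ d.hom_ext ?_ fun j k ↦ ?_,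
    d.hom_ext (by rw [reassoc_of% hh, h₂]) fun j g ↦ by rw [reassoc_of% hh', hy₄]⟩
  · rw [← d.inl.naturality_assoc, hh, h₁ f hf ht]
  · rw [d.cell_map_assoc, hh']
    -- If k lies in the boundary, so does `k ≫ f`, and both sides come from e. Otherwise `k ≫ f` is
    -- strictly raising, and its value was prescribed by l.
    by_cases hk : ρ.degHom k < n
    · rw [hy₂ j (k ≫ f) ((ρ.degHom_comp_le_left k f).trans_lt hk), d.m_comp j k f hk,
        d.cell_of_lt j k hk, Category.assoc, Category.assoc, h₁ f hf ht]
    · have hk' : Rp k := ρ.prop₂_of_not_degHom_lt k (by rwa [j.2])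
      have hkf : Rp (k ≫ f) := Rp.comp_mem _ _ hk' hf
      have hj : ρ.deg j.1 < ρ.deg s := (ρ.le₂ k hk').trans_lt ht
      rw [hy₃ j (k ≫ f) hkf hj (by rw [ρ.degHom_eq_of_prop₂ _ hkf, j.2]; exact lt_irrefl n),
        ← l.map_app k f hk' hf hj ht, d.cell_map_assoc, Category.id_comp]

end AttachingData

end ReedyStructure

end HomotopicalAlgebra

/-! ### Factorizations -/

namespace HomotopicalAlgebra

namespace ReedyStructure

variable {R : Type v} [SmallCategory R] {Rm Rp : MorphismProperty R}
  [Rm.IsMultiplicative] [Rp.IsMultiplicative] (ρ : ReedyStructure Rm Rp ℕ)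
  {M : Type u} [Category.{v} M]

/-- A map given on `∂R(r, -)`, compatibly with postcompositions, is determined by its values on
the maps of `Rm` which lower the degree. -/
lemma map_boundary_ext {r : R} {A : M} {Φ : R ⥤ M}
    {x y : ∀ ⦃s : R⦄ (g : r ⟶ s), ρ.degHom g < ρ.deg r → (A ⟶ Φ.obj s)}
    (hx : ∀ ⦃s t : R⦄ (g : r ⟶ s) (k : s ⟶ t) hg hgk, x (g ≫ k) hgk = x g hg ≫ Φ.map k)
    (hy : ∀ ⦃s t : R⦄ (g : r ⟶ s) (k : s ⟶ t) hg hgk, y (g ≫ k) hgk = y g hg ≫ Φ.map k)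
    (h : ∀ ⦃s : R⦄ (g : r ⟶ s) hg, Rm g → ρ.deg s < ρ.deg r → x g hg = y g hg)
    ⦃s : R⦄ (g : r ⟶ s) (hg : ρ.degHom g < ρ.deg r) : x g hg = y g hg := by
  obtain ⟨t, a, b, ha, hb, rfl, ht⟩ := ρ.exists_fac g
  have ha' : ρ.degHom a < ρ.deg r := by
    rw [ρ.degHom_eq_of_prop₁ a ha]
    lia
  rw [hx a b ha', hy a b ha', h a ha' ha (by lia)]

section

variable [HasLimits M]

lemma matchingObjMap_comp {Φ Φ' Φ'' : R ⥤ M} (α : Φ ⟶ Φ') (β : Φ' ⟶ Φ'') (r : R) :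
    ρ.matchingObjMap r (α ≫ β) = ρ.matchingObjMap r α ≫ ρ.matchingObjMap r β :=
  ρ.matchingObj_hom_ext fun s f hf hs ↦ by
    rw [Category.assoc, matchingObjMap_matchingπ, matchingObjMap_matchingπ,
      ← Category.assoc, matchingObjMap_matchingπ, Category.assoc, NatTrans.comp_app]

lemma isIso_matchingObjMap {Φ Φ' : R ⥤ M} (α : Φ ⟶ Φ') (r : R)
    (h : ∀ s, ρ.deg s < ρ.deg r → IsIso (α.app s)) : IsIso (ρ.matchingObjMap r α) := by
  have (f : ρ.MatchingCategory r) :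
      IsIso ((Functor.whiskerLeft (ρ.matchingForget r) α).app f) := h _ f.property
  have := NatIso.isIso_of_isIso_app (Functor.whiskerLeft (ρ.matchingForget r) α)
  exact isIso_limMap _

/-- M_r depends only on degrees below deg r, where α is invertible, so q is isomorphic to the
relative matching map of π. This lets a factorization chosen at one stage survive to later ones. -/
lemma relativeMatchingMap_mem {W : MorphismProperty M} [W.RespectsIso] {E E' Ψ : R ⥤ M}
    (α : E ⟶ E') (π : E' ⟶ Ψ) (r : R) (h : ∀ s, ρ.deg s < ρ.deg r → IsIso (α.app s)) {F : M}
    (u : F ⟶ E'.obj r) [IsIso u]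
    (q : F ⟶ pullback (ρ.matchingObjMap r (α ≫ π)) (ρ.matchingMap r Ψ)) (hq : W q)
    (h₁ : q ≫ pullback.fst _ _ ≫ ρ.matchingObjMap r α = u ≫ ρ.matchingMap r E')
    (h₂ : q ≫ pullback.snd _ _ = u ≫ π.app r) : W (ρ.relativeMatchingMap r π) := by
  have := ρ.isIso_matchingObjMap α r h
  let φ : pullback (ρ.matchingObjMap r (α ≫ π)) (ρ.matchingMap r Ψ) ⟶
      pullback (ρ.matchingObjMap r π) (ρ.matchingMap r Ψ) :=
    pullback.map _ _ _ _ (ρ.matchingObjMap r α) (𝟙 _) (𝟙 _)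
      (by rw [Category.comp_id, matchingObjMap_comp]) (by simp)
  have : IsIso φ := inferInstance
  have fac : ρ.relativeMatchingMap r π = inv u ≫ q ≫ φ := by
    rw [IsIso.eq_inv_comp]
    apply pullback.hom_ext
    · rw [Category.assoc, Category.assoc, relativeMatchingMap_fst, ← h₁]
      congr 1
      exact (pullback.lift_fst _ _ _).symm
    · rw [Category.assoc, Category.assoc, relativeMatchingMap_snd, ← h₂]
      congr 1
      exact ((pullback.lift_snd _ _ _).trans (Category.comp_id _)).symm
  rw [fac]
  exact (W.cancel_left_of_respectsIso _ _).2 ((W.cancel_right_of_respectsIso _ _).2 hq)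

variable [HasColimits M]

/-- The inductive step of the factorization. -/
lemma exists_factorization_step (L W : MorphismProperty M) [L.HasFactorization W]
    (hLW : L ≤ W.llp) {E Ψ : R ⥤ M} (π : E ⟶ Ψ) (n : ℕ) :
    ∃ (E' : R ⥤ M) (α : E ⟶ E') (π' : E' ⟶ Ψ), α ≫ π' = π ∧
      (∀ s, ρ.deg s < n → IsIso (α.app s)) ∧ (ρ.pullbackCotensorClass W).llp α ∧
      ∀ r, ρ.deg r = n → ∃ (F : M) (u : F ⟶ E'.obj r)
        (q : F ⟶ pullback (ρ.matchingObjMap r π) (ρ.matchingMap r Ψ)), IsIso u ∧ W q ∧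
        q ≫ pullback.fst _ _ ≫ ρ.matchingObjMap r α = u ≫ ρ.matchingMap r E' ∧
        q ≫ pullback.snd _ _ = u ≫ π'.app r := by
  let fac (j : { r : R // ρ.deg r = n }) :=
    MorphismProperty.factorizationData L W (ρ.relativeMatchingMap j.1 π)
  have H (j : { r : R // ρ.deg r = n }) :=
    (ρ.matchingFamily ((fac j).p ≫ pullback.fst _ _)).exists_extension
  choose m hm hm' using H
  -- The W-part projects to a map F r → M_r E, whose components extend to all of ∂R(r, -).
  -- Identities between such extensions need checking only on strictly lowering maps.
  let d : ρ.AttachingData E n :=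
    { F j := (fac j).Z
      i j := (fac j).i
      m j s g hg := m j g (hg.trans_eq j.2.symm)
      m_comp j s t g k hg hgk := hm' j g k _ _
      i_m j s g hg := by
        refine ρ.map_boundary_ext (x := fun s g hg ↦ (fac j).i ≫ m j g hg)
          (y := fun s g _ ↦ E.map g) (fun s t g k hg hgk ↦ ?_) (fun s t g k _ _ ↦ E.map_comp g k)
          (fun s g hg hg' hs ↦ ?_) g (hg.trans_eq j.2.symm)
        · rw [hm' j g k hg hgk, Category.assoc]
        · rw [hm j g hg' hs, matchingFamily_app, Category.assoc, (fac j).fac_assoc,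
            relativeMatchingMap_fst_assoc, matchingMap_matchingπ] }
  obtain ⟨π', h₁, h₂⟩ := d.exists_desc_natTrans π (fun j ↦ (fac j).p ≫ pullback.snd _ _)
    (fun j ↦ by
      change (fac j).i ≫ _ = _
      rw [(fac j).fac_assoc, relativeMatchingMap_snd])
    (fun j s g hg ↦ by
      refine ρ.map_boundary_ext (x := fun s g hg ↦ m j g hg ≫ π.app s)
          (y := fun s g _ ↦ ((fac j).p ≫ pullback.snd _ _) ≫ Ψ.map g)
          (fun s t g k hg hgk ↦ ?_) (fun s t g k _ _ ↦ by simp only [Ψ.map_comp, Category.assoc])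
          (fun s g hg hg' hs ↦ ?_) g (hg.trans_eq j.2.symm)
      · rw [hm' j g k hg hgk, Category.assoc, π.naturality, Category.assoc]
      · rw [hm j g hg' hs, matchingFamily_app, Category.assoc, Category.assoc,
          ← matchingObjMap_matchingπ, pullback.condition_assoc, matchingMap_matchingπ, Category.assoc])
  refine ⟨d.obj, d.inl, π', h₁, fun s hs ↦ d.isIso_inl_app hs, ?_, fun r hr ↦
    ⟨d.F ⟨r, hr⟩, d.cell ⟨r, hr⟩ (𝟙 r), (fac ⟨r, hr⟩).p, d.isIso_cell_id ⟨r, hr⟩,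
      (fac ⟨r, hr⟩).hp, ?_, (h₂ ⟨r, hr⟩).symm⟩⟩
  · rw [llp_pullbackCotensorClass_iff]
    exact fun r T B p hp ↦ d.latchLift_inl r p fun j ↦ hLW _ (fac j).hi _ hp
  · refine ρ.matchingObj_hom_ext fun s f hf hs ↦ ?_
    have hf' : ρ.degHom f < ρ.deg r := by rwa [ρ.degHom_eq_of_prop₁ f hf]
    rw [Category.assoc, Category.assoc, Category.assoc, matchingObjMap_matchingπ,
      matchingMap_matchingπ, d.cell_map, Category.id_comp, d.cell_of_lt ⟨r, hr⟩ f (by lia)]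
    rw [show d.m ⟨r, hr⟩ f (by lia) = _ from hm ⟨r, hr⟩ f hf hs hf', matchingFamily_app]
    simp only [Category.assoc]

/-- The factorizations of the Reedy weak factorization system. -/
lemma exists_factorization (L W : MorphismProperty M) [L.HasFactorization W] [W.RespectsIso]
    (hLW : L ≤ W.llp) {Φ Ψ : R ⥤ M} (τ : Φ ⟶ Ψ) :
    ∃ (E : R ⥤ M) (i : Φ ⟶ E) (π : E ⟶ Ψ), i ≫ π = τ ∧ (ρ.pullbackCotensorClass W).llp i ∧
      ∀ r, W (ρ.relativeMatchingMap r π) := by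
  have step (n : ℕ) (Z : Σ E : R ⥤ M, (E ⟶ Ψ)) := ρ.exists_factorization_step L W hLW Z.2 n
  choose E' α' π' h₁' h₂' h₃' h₄' using step
  let Z (n : ℕ) : Σ E : R ⥤ M, (E ⟶ Ψ) :=
    Nat.rec ⟨Φ, τ⟩ (fun n Z ↦ ⟨E' n Z, π' n Z⟩) n
  let X (n : ℕ) : R ⥤ M := (Z n).1
  let π (n : ℕ) : X n ⟶ Ψ := (Z n).2
  let α (n : ℕ) : X n ⟶ X (n + 1) := α' n (Z n)
  have h₁ (n : ℕ) : α n ≫ π (n + 1) = π n := h₁' n (Z n)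
  have h₂ (n : ℕ) : ∀ s, ρ.deg s < n → IsIso ((α n).app s) := h₂' n (Z n)
  have h₃ (n : ℕ) : (ρ.pullbackCotensorClass W).llp (α n) := h₃' n (Z n)
  have h₄ (n : ℕ) : ∀ r, ρ.deg r = n → ∃ (F : M) (u : F ⟶ (X (n + 1)).obj r)
      (q : F ⟶ pullback (ρ.matchingObjMap r (π n)) (ρ.matchingMap r Ψ)), IsIso u ∧ W q ∧
      q ≫ pullback.fst _ _ ≫ ρ.matchingObjMap r (α n) = u ≫ ρ.matchingMap r (X (n + 1)) ∧
      q ≫ pullback.snd _ _ = u ≫ (π (n + 1)).app r := h₄' n (Z n)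
  let S : ℕ ⥤ (R ⥤ M) := Functor.ofSequence α
  have hS (n : ℕ) : S.map (homOfLE n.le_succ) = α n := Functor.ofSequence_map_homOfLE_succ α n
  let ι (n : ℕ) : X n ⟶ colimit S := colimit.ι S n
  have hι (n : ℕ) : α n ≫ ι (n + 1) = ι n := by
    rw [← hS]
    exact colimit.w S _
  obtain ⟨π₀, hπ₀⟩ : ∃ π₀ : colimit S ⟶ Ψ, ∀ n, ι n ≫ π₀ = π n :=
    ⟨colimit.desc S ⟨Ψ, NatTrans.ofSequence (F := S) (G := (Functor.const ℕ).obj Ψ) π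
      (fun n ↦ by
        rw [show S.map (homOfLE (n.le_add_right 1)) = α n from hS n]
        exact (h₁ n).trans (Category.comp_id _).symm)⟩, fun n ↦ colimit.ι_desc _ _⟩
  -- Evaluation at s preserves the colimit, and the evaluated sequence is constant up to isomorphism
  -- from stage n on.
  have hiso (n : ℕ) (s : R) (hs : ρ.deg s < n) : IsIso ((ι n).app s) := by
    have hc := isColimitOfPreserves ((evaluation R M).obj s) (colimit.isColimit S)
    refine Functor.IsEventuallyConstantFrom.isIso_ι_of_isColimit (i₀ := n) ?_ hc
    intro m φ
    obtain ⟨k, rfl⟩ := Nat.exists_eq_add_of_le (leOfHom φ)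
    obtain rfl := Subsingleton.elim φ (homOfLE (n.le_add_right k))
    induction k with
    | zero =>
      rw [show homOfLE (n.le_add_right 0) = 𝟙 n from rfl]
      infer_instance
    | succ k hk =>
      rw [show homOfLE (n.le_add_right (k + 1)) =
        homOfLE (n.le_add_right k) ≫ homOfLE (n + k).le_succ from rfl, Functor.map_comp]
      have h : IsIso ((S ⋙ (evaluation R M).obj s).map (homOfLE (n + k).le_succ)) := by
        change IsIso ((S.map (homOfLE (n + k).le_succ)).app s)
        rw [hS]
        exact h₂ _ _ (by lia)
      have := hk
      exact IsIso.comp_isIso' this h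
  refine ⟨colimit S, ι 0, π₀, hπ₀ 0, ?_, fun r ↦ ?_⟩
  · refine MorphismProperty.transfiniteCompositionsOfShape_le
      (ρ.pullbackCotensorClass W).llp ℕ _
      ⟨{ F := S, isoBot := Iso.refl _, incl := (colimit.cocone S).ι,
         isColimit := colimit.isColimit S, fac := Category.id_comp _,
         map_mem := fun j _ ↦ ?_ }⟩
    exact (hS j) ▸ h₃ j
  · obtain ⟨F, u, q, hu, hq, e₁, e₂⟩ := h₄ _ r rfl
    have := hiso (ρ.deg r + 1) r (by lia)
    have e := hπ₀ (ρ.deg r)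
    generalize hn : ρ.deg r = n at *
    -- The type of q mentions `π n`, so that map is replaced by `ι n ≫ π₀` through substitution
    -- rather than rewriting.
    generalize π n = π₁ at *
    subst e
    refine ρ.relativeMatchingMap_mem (ι n) π₀ r (fun s hs ↦ hiso _ s (by lia))
      (u ≫ (ι (n + 1)).app r) q hq ?_ ?_
    · rw [← congrArg (ρ.matchingObjMap r) (hι n)]
      refine (congrArg (q ≫ pullback.fst _ _ ≫ ·) (ρ.matchingObjMap_comp _ _ r)).trans ?_
      rw [reassoc_of% e₁, matching_comm, Category.assoc]
    · rw [e₂, Category.assoc, ← NatTrans.comp_app, hπ₀]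

end

end ReedyStructure

end HomotopicalAlgebra

/-! ### Reedy weak factorization systems and the model structure -/

namespace HomotopicalAlgebra

namespace ReedyStructure

variable {R : Type v} [SmallCategory R] {Rm Rp : MorphismProperty R}
  [Rm.IsMultiplicative] [Rp.IsMultiplicative] (ρ : ReedyStructure Rm Rp ℕ)
  {M : Type u} [Category.{v} M]

/-- Transport the problem along the inclusions of the retract, solve it there, and project back.
Working with families avoids any functoriality of relative matching maps. -/
lemma MatchLift.of_retract {Φ Ψ Φ' Ψ' : R ⥤ M} {π : Φ ⟶ Ψ} {π' : Φ' ⟶ Ψ'} {r : R} {A B : M}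
    {i : A ⟶ B} (H : ρ.MatchLift i r π') (h : RetractArrow π π') : ρ.MatchLift i r π := by
  intro a m b h₁ h₂ h₃
  have wi (s : R) : h.left.i.app s ≫ π'.app s = π.app s ≫ h.right.i.app s :=
    congrArg (fun f : Φ ⟶ Ψ' ↦ f.app s) h.i_w
  have wr (s : R) : h.left.r.app s ≫ π.app s = π'.app s ≫ h.right.r.app s :=
    congrArg (fun f : Φ' ⟶ Ψ ↦ f.app s) h.r_w
  have hl (s : R) : h.left.i.app s ≫ h.left.r.app s = 𝟙 _ :=
    congrArg (fun f : Φ ⟶ Φ ↦ f.app s) h.left.retract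
  have hr (s : R) : h.right.i.app s ≫ h.right.r.app s = 𝟙 _ :=
    congrArg (fun f : Ψ ⟶ Ψ ↦ f.app s) h.right.retract
  let m' : ρ.MatchingFamily r B Φ' :=
    { app f hf hs := m.app f hf hs ≫ h.left.i.app _
      app_map f k hf hk hs ht := by
        rw [Category.assoc, ← NatTrans.naturality, ← Category.assoc, m.app_map f k hf hk hs ht] }
  obtain ⟨l, l₁, l₂, l₃⟩ := H (a ≫ h.left.i.app r) m' (b ≫ h.right.i.app r)
    (fun s f hf hs ↦ by
      rw [Category.assoc, ← NatTrans.naturality, reassoc_of% h₁ f hf hs])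
    (by rw [Category.assoc, wi, reassoc_of% h₂])
    (fun s f hf hs ↦ by
      change (m.app f hf hs ≫ h.left.i.app s) ≫ _ = _
      rw [Category.assoc, wi, reassoc_of% h₃ f hf hs, Category.assoc, NatTrans.naturality])
  refine ⟨l ≫ h.left.r.app r, ?_, fun s f hf hs ↦ ?_, ?_⟩
  · rw [reassoc_of% l₁, hl, Category.comp_id]
  · rw [Category.assoc, ← NatTrans.naturality, reassoc_of% l₂ f hf hs]
    change (m.app f hf hs ≫ h.left.i.app s) ≫ _ = _
    rw [Category.assoc, hl, Category.comp_id]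
  · rw [Category.assoc, wr, reassoc_of% l₃, hr, Category.comp_id]

variable [HasLimits M] [HasColimits M]

/-- The class of maps whose relative latching maps belong to `L`. -/
def reedyLeft (L : MorphismProperty M) : MorphismProperty (R ⥤ M) :=
  fun _ _ τ ↦ ∀ r, L (ρ.relativeLatchingMap r τ)

/-- The class of maps whose relative matching maps belong to `W`. -/
def reedyRight (W : MorphismProperty M) : MorphismProperty (R ⥤ M) :=
  fun _ _ π ↦ ∀ r, W (ρ.relativeMatchingMap r π)

lemma llp_pullbackCotensorClass {L X : MorphismProperty M} (h : L = X.llp) :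
    (ρ.pullbackCotensorClass X).llp = ρ.reedyLeft L := by
  ext Φ Ψ τ
  rw [llp_pullbackCotensorClass_iff_relativeLatchingMap, h]
  rfl

section

omit [HasLimits M] in
lemma latchLift_of_reedyLeft (L W : MorphismProperty M) [L.IsWeakFactorizationSystem W]
    {Φ Ψ : R ⥤ M} {τ : Φ ⟶ Ψ} (hτ : ρ.reedyLeft L τ) (r : R) {E B : M}
    (p : E ⟶ B) (hp : W p) : ρ.LatchLift τ r p :=
  (ρ.hasLiftingProperty_relativeLatchingMap_iff τ p).1
    (MorphismProperty.hasLiftingProperty_of_wfs _ _ (hτ r) hp)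

omit [HasColimits M] in
lemma reedyRight_iff (L W : MorphismProperty M) [L.IsWeakFactorizationSystem W]
    {Φ Ψ : R ⥤ M} (π : Φ ⟶ Ψ) :
    ρ.reedyRight W π ↔ ∀ (r : R) ⦃A B : M⦄ (i : A ⟶ B), L i → ρ.MatchLift i r π := by
  refine forall_congr' fun r ↦ ?_
  rw [← MorphismProperty.rlp_eq_of_wfs L W]
  exact ⟨fun h _ _ i hi ↦ (ρ.hasLiftingProperty_relativeMatchingMap_iff i π).1 (h i hi),
    fun h _ _ i hi ↦ (ρ.hasLiftingProperty_relativeMatchingMap_iff i π).2 (h i hi)⟩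

/-- The Reedy weak factorization system. -/
instance isWeakFactorizationSystem_reedy (L W : MorphismProperty M) [L.IsWeakFactorizationSystem W] :
    (ρ.reedyLeft L).IsWeakFactorizationSystem (ρ.reedyRight W) := by
  have hL : L = W.llp := (MorphismProperty.llp_eq_of_wfs L W).symm
  have hW : W = L.rlp := (MorphismProperty.rlp_eq_of_wfs L W).symm
  have : W.RespectsIso := by
    rw [hW]
    infer_instance
  have : (ρ.reedyLeft L).HasFactorization (ρ.reedyRight W) := ⟨fun τ ↦ by
    obtain ⟨E, i, π, fac, hi, hπ⟩ := ρ.exists_factorization L W hL.le τ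
    rw [ρ.llp_pullbackCotensorClass hL] at hi
    exact ⟨{ Z := E, i := i, p := π, fac := fac, hi := hi, hp := hπ }⟩⟩
  have : (ρ.reedyLeft L (M := M)).IsStableUnderRetracts := by
    rw [← ρ.llp_pullbackCotensorClass hL]
    infer_instance
  have : (ρ.reedyRight W (M := M)).IsStableUnderRetracts := ⟨fun h hπ ↦ by
    rw [ρ.reedyRight_iff L W] at hπ ⊢
    exact fun r _ _ i hi ↦ MatchLift.of_retract ρ (hπ r i hi) h⟩
  refine .mk' _ _ fun i p hi hp ↦ ρ.hasLiftingProperty_of_relative i p fun r ↦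
    MorphismProperty.hasLiftingProperty_of_wfs _ _ (hi r) (hp r)

omit [HasLimits M] in
lemma app_mem_of_reedyLeft (L W : MorphismProperty M) [L.IsWeakFactorizationSystem W]
    {Φ Ψ : R ⥤ M} {τ : Φ ⟶ Ψ} (hτ : ρ.reedyLeft L τ) (r : R) :
    L (τ.app r) := by
  rw [← MorphismProperty.llp_eq_of_wfs L W]
  exact fun _ _ p hp ↦ ρ.hasLiftingProperty_app_of_latchLift τ p r
    fun s _ ↦ ρ.latchLift_of_reedyLeft L W hτ s p hp

omit [HasColimits M] in
lemma app_mem_of_reedyRight (L W : MorphismProperty M) [L.IsWeakFactorizationSystem W]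
    {Φ Ψ : R ⥤ M} {π : Φ ⟶ Ψ} (hπ : ρ.reedyRight W π) (r : R) :
    W (π.app r) := by
  rw [← MorphismProperty.rlp_eq_of_wfs L W]
  rw [ρ.reedyRight_iff L W] at hπ
  exact fun _ _ i hi ↦ ρ.hasLiftingProperty_app_of_matchLift π i r fun s _ ↦ hπ s i hi

-- Only degrees below deg r enter, as required for use inside an induction on the degree.
omit [HasLimits M] in
lemma latchingObjMap_mem (L W : MorphismProperty M) [L.IsWeakFactorizationSystem W]
    {Φ Ψ : R ⥤ M} {τ : Φ ⟶ Ψ} (r : R)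
    (hτ : ∀ s, ρ.deg s < ρ.deg r → L (ρ.relativeLatchingMap s τ)) :
    L (ρ.latchingObjMap r τ) := by
  rw [← MorphismProperty.llp_eq_of_wfs L W]
  exact fun _ _ p hp ↦ ρ.hasLiftingProperty_latchingObjMap_of_latchLift τ p r fun s hs ↦
    (ρ.hasLiftingProperty_relativeLatchingMap_iff τ p).1
      (MorphismProperty.hasLiftingProperty_of_wfs _ _ (hτ s hs) hp)

end

section

variable [ModelCategory M]

-- By induction L_r Φ → L_r Ψ is a trivial cofibration, hence so is its pushout out of Φ r.
-- Two-out-of-three with τ at r then makes the relative latching map a weak equivalence.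
omit [HasLimits M] in
lemma reedyLeft_trivialCofibrations {Φ Ψ : R ⥤ M} (τ : Φ ⟶ Ψ) :
    ρ.reedyLeft (trivialCofibrations M) τ ↔
      ρ.reedyLeft (cofibrations M) τ ∧ ∀ r, weakEquivalences M (τ.app r) := by
  refine ⟨fun h ↦ ⟨fun r ↦ (h r).1, fun r ↦ (ρ.app_mem_of_reedyLeft _ (fibrations M) h r).2⟩,
    fun ⟨h, h'⟩ ↦ ?_⟩
  suffices ∀ n r, ρ.deg r = n → trivialCofibrations M (ρ.relativeLatchingMap r τ) from
    fun r ↦ this _ r rfl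
  intro n
  induction n using Nat.strong_induction_on with
  | h n hn =>
    intro r hr
    have h₁ : trivialCofibrations M (ρ.latchingObjMap r τ) :=
      ρ.latchingObjMap_mem _ (fibrations M) r fun s hs ↦ hn _ (by lia) s rfl
    rw [mem_trivialCofibrations_iff] at h₁
    obtain ⟨_, _⟩ := h₁
    refine ⟨h r, ?_⟩
    exact MorphismProperty.of_precomp _ (pushout.inl (ρ.latchingMap r Φ) (ρ.latchingObjMap r τ)) _
      (mem_weakEquivalences _) (by rw [inl_relativeLatchingMap]; exact h' r)

/-- A retract argument replaces the dual induction. Factor π through the system whose right class is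
the Reedy one for trivial fibrations. By two-out-of-three the left factor is an objectwise weak
equivalence, hence in the Reedy class of trivial cofibrations. It therefore lifts against π, making
π a retract of the right factor. -/
lemma reedyRight_trivialFibrations {Φ Ψ : R ⥤ M} (π : Φ ⟶ Ψ) :
    ρ.reedyRight (trivialFibrations M) π ↔
      ρ.reedyRight (fibrations M) π ∧ ∀ r, weakEquivalences M (π.app r) := by
  refine ⟨fun h ↦ ⟨fun r ↦ (h r).1, fun r ↦ (ρ.app_mem_of_reedyRight (cofibrations M) _ h r).2⟩,
    fun ⟨h, h'⟩ ↦ ?_⟩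
  let fac := MorphismProperty.factorizationData (ρ.reedyLeft (cofibrations M))
    (ρ.reedyRight (trivialFibrations M)) π
  have hi : ρ.reedyLeft (trivialCofibrations M) fac.i := by
    rw [reedyLeft_trivialCofibrations]
    refine ⟨fac.hi, fun r ↦ ?_⟩
    refine MorphismProperty.of_postcomp _ _ (fac.p.app r)
      (ρ.app_mem_of_reedyRight (cofibrations M) _ fac.hp r).2 ?_
    rw [← NatTrans.comp_app, fac.fac]
    exact h' r
  have := MorphismProperty.hasLiftingProperty_of_wfs fac.i π hi h
  have : (ρ.reedyRight (trivialFibrations M)).IsStableUnderRetracts := by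
    rw [← MorphismProperty.rlp_eq_of_wfs (ρ.reedyLeft (cofibrations M)) (ρ.reedyRight _)]
    infer_instance
  exact MorphismProperty.of_retract (P := ρ.reedyRight (trivialFibrations M))
    (RetractArrow.ofRightLiftingProperty fac.fac) fac.hp

/-- The Reedy model structure. -/
abbrev reedyModelCategory : ModelCategory (R ⥤ M) :=
  letI : CategoryWithFibrations (R ⥤ M) := ⟨ρ.reedyRight (fibrations M)⟩
  letI : CategoryWithCofibrations (R ⥤ M) := ⟨ρ.reedyLeft (cofibrations M)⟩
  letI : CategoryWithWeakEquivalences (R ⥤ M) :=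
    ⟨fun _ _ τ ↦ ∀ r, weakEquivalences M (τ.app r)⟩
  haveI : (weakEquivalences (R ⥤ M)).HasTwoOutOfThreeProperty :=
    { comp_mem f g hf hg r := MorphismProperty.comp_mem _ _ _ (hf r) (hg r)
      of_postcomp f g hg hfg r := MorphismProperty.of_postcomp _ _ _ (hg r) (hfg r)
      of_precomp f g hf hfg r := MorphismProperty.of_precomp _ _ _ (hf r) (hfg r) }
  have h₁ : trivialFibrations (R ⥤ M) = ρ.reedyRight (trivialFibrations M) := by
    ext _ _ π
    exact (ρ.reedyRight_trivialFibrations π).symm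
  have h₂ : trivialCofibrations (R ⥤ M) = ρ.reedyLeft (trivialCofibrations M) := by
    ext _ _ τ
    exact (ρ.reedyLeft_trivialCofibrations τ).symm
  haveI : (cofibrations (R ⥤ M)).IsWeakFactorizationSystem (trivialFibrations (R ⥤ M)) := by
    rw [h₁]
    exact ρ.isWeakFactorizationSystem_reedy _ _
  haveI : (trivialCofibrations (R ⥤ M)).IsWeakFactorizationSystem (fibrations (R ⥤ M)) := by
    rw [h₂]
    exact ρ.isWeakFactorizationSystem_reedy _ _
  ModelCategory.mk' _

lemma isReedyModelStructure_reedyModelCategory :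
    letI := ρ.reedyModelCategory (M := M)
    ρ.IsReedyModelStructure (M := M) :=
  letI := ρ.reedyModelCategory (M := M)
  { weakEquivalences_iff _ := Iff.rfl
    cofibrations_iff _ := Iff.rfl
    fibrations_iff _ := Iff.rfl }

/-- A generating class matters only through its llp, so stating this for any X' and Z' with the
right llp covers both generating pairs. -/
lemma isFibrantlyGeneratedBy_reedyModelCategory {X Z : MorphismProperty M}
    (hXZ : IsFibrantlyGeneratedBy M X Z) {X' Z' : MorphismProperty (R ⥤ M)}
    (hX' : X'.llp = (ρ.pullbackCotensorClass X).llp)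
    (hZ' : Z'.llp = (ρ.pullbackCotensorClass Z).llp) :
    letI := ρ.reedyModelCategory (M := M)
    IsFibrantlyGeneratedBy (R ⥤ M) X' Z' :=
  letI := ρ.reedyModelCategory (M := M)
  { fibrations :=
      { isWeakFactorizationSystem := inferInstance
        eq_llp := by
          rw [hX', ρ.llp_pullbackCotensorClass hXZ.fibrations.eq_llp]
          ext _ _ τ
          exact (ρ.reedyLeft_trivialCofibrations τ).symm }
    trivialFibrations :=
      { isWeakFactorizationSystem := inferInstance
        eq_llp := by
          rw [hZ', ρ.llp_pullbackCotensorClass hXZ.trivialFibrations.eq_llp]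
          rfl } }

end

end ReedyStructure

end HomotopicalAlgebra

/-! ### Comparison of pullback-cotensors with opposite pushout-products -/

namespace HomotopicalAlgebra

section

variable {R : Type v} [SmallCategory R] {M : Type u} [Category.{v} M] [HasColimits M]

/-- The tensor `A ⊗ F`. -/
noncomputable abbrev tensor (A : M) (F : R ⥤ Type v) : R ⥤ M :=
  ((tensorFunctor R M).obj A).obj F

/-- The inclusion `A ⟶ (A ⊗ F)(s)` corresponding to `x : F s`. -/
noncomputable def tensorι (A : M) (F : R ⥤ Type v) (s : R) (x : F.obj s) :
    A ⟶ (tensor A F).obj s :=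
  Sigma.ι (fun _ : F.obj s ↦ A) x

lemma tensor_obj_hom_ext {A : M} {F : R ⥤ Type v} {s : R} {T : M}
    {a b : (tensor A F).obj s ⟶ T} (h : ∀ x, tensorι A F s x ≫ a = tensorι A F s x ≫ b) : a = b :=
  Sigma.hom_ext _ _ h

/-- The map from `(A ⊗ F)(s)` with given components. -/
noncomputable def tensorObjDesc {A : M} {F : R ⥤ Type v} (s : R) {T : M}
    (y : F.obj s → (A ⟶ T)) : (tensor A F).obj s ⟶ T :=
  Sigma.desc y

lemma tensorι_objDesc {A : M} {F : R ⥤ Type v} (s : R) {T : M} (y : F.obj s → (A ⟶ T))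
    (x : F.obj s) : tensorι A F s x ≫ tensorObjDesc s y = y x :=
  Sigma.ι_desc _ _

lemma tensorι_map (A : M) (F : R ⥤ Type v) {s t : R} (k : s ⟶ t) (x : F.obj s) :
    tensorι A F s x ≫ (tensor A F).map k = tensorι A F t (F.map k x) :=
  (Sigma.ι_desc _ _).trans (Category.id_comp _)

lemma tensorι_map_app (A : M) {F G : R ⥤ Type v} (κ : F ⟶ G) (s : R) (x : F.obj s) :
    tensorι A F s x ≫ (((tensorFunctor R M).obj A).map κ).app s = tensorι A G s (κ.app s x) :=
  (Sigma.ι_desc _ _).trans (Category.id_comp _)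

lemma tensorι_map_app' {A B : M} (i : A ⟶ B) (F : R ⥤ Type v) (s : R) (x : F.obj s) :
    tensorι A F s x ≫ (((tensorFunctor R M).map i).app F).app s = i ≫ tensorι B F s x :=
  Sigma.ι_map (f := fun _ : F.obj s ↦ A) (g := fun _ ↦ B) (fun _ ↦ i) x

end

section

variable {R : Type v} [SmallCategory R] {M : Type u} [Category.{v} M] [HasLimits M]
  {C C' G G' : Rᵒᵖ ⥤ Type v}

/-- The opposite of a cotensor is a tensor in the opposite category. -/
noncomputable def tensorToOpCotensor (e : C ≅ G) (E : M) :
    tensor (op E) C ⟶ (Functor.opHom R M).obj (op (cotensor G E)) where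
  app s := tensorObjDesc s fun x ↦ (cotensorπ G E s.unop (e.hom.app s x)).op
  naturality s t k := tensor_obj_hom_ext fun x ↦ by
    rw [← Category.assoc, tensorι_map, tensorι_objDesc, ← Category.assoc, tensorι_objDesc]
    refine Eq.trans ?_ (congrArg Quiver.Hom.op (cotensor_map_π G E k.unop (e.hom.app s x))).symm
    exact congrArg (fun y ↦ (cotensorπ G E t.unop y).op) (NatTrans.naturality_apply e.hom k x)

lemma tensorι_tensorToOpCotensor (e : C ≅ G) (E : M) (s : Rᵒᵖ) (x : C.obj s) :
    tensorι (op E) C s x ≫ (tensorToOpCotensor e E).app s =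
      (cotensorπ G E s.unop (e.hom.app s x)).op :=
  tensorι_objDesc _ _ _

instance (e : C ≅ G) (E : M) : IsIso (tensorToOpCotensor e E) := by
  have (s : Rᵒᵖ) : IsIso ((tensorToOpCotensor e E).app s) := by
    refine ⟨(cotensorObjLift G s.unop
      fun y ↦ (tensorι (op E) C s (e.inv.app s y)).unop).op, ?_, ?_⟩
    · refine tensor_obj_hom_ext fun x ↦ ?_
      rw [← Category.assoc, tensorι_tensorToOpCotensor, Category.comp_id]
      refine (congrArg Quiver.Hom.op (cotensorObjLift_π G s.unop _ _)).trans ?_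
      rw [Quiver.Hom.op_unop]
      exact congrArg (tensorι (op E) C s) (by simp)
    · refine Quiver.Hom.unop_inj (cotensor_obj_hom_ext fun y ↦ ?_)
      apply Quiver.Hom.op_inj
      have h := congrArg Quiver.Hom.op (cotensorObjLift_π G s.unop
        (fun y ↦ (tensorι (op E) C s (e.inv.app s y)).unop) y)
      refine (Category.assoc _ _ _).symm.trans ((congrArg (· ≫ _) h).trans ?_)
      refine (tensorι_tensorToOpCotensor e E s _).trans (Eq.trans ?_ (Category.comp_id _).symm)
      exact congrArg (fun y ↦ (cotensorπ G E s.unop y).op) (by simp)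
  exact NatIso.isIso_of_isIso_app _

lemma tensor_map_comp_tensorToOpCotensor (e : C ≅ G) (e' : C' ≅ G') (κ : C ⟶ C') (κ' : G ⟶ G')
    (h : κ ≫ e'.hom = e.hom ≫ κ') (E : M) :
    ((tensorFunctor Rᵒᵖ Mᵒᵖ).obj (op E)).map κ ≫ tensorToOpCotensor e' E =
      tensorToOpCotensor e E ≫
        (Functor.opHom R M).map (((cotensorFunctor R M).map κ'.op).app E).op := by
  ext s
  refine tensor_obj_hom_ext fun x ↦ ?_
  rw [NatTrans.comp_app, NatTrans.comp_app, ← Category.assoc, ← Category.assoc, tensorι_map_app,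
    tensorι_tensorToOpCotensor, tensorι_tensorToOpCotensor]
  refine Eq.trans ?_ (congrArg Quiver.Hom.op
    (cotensor_map_app_π κ' E s.unop (e.hom.app s x))).symm
  exact congrArg (fun y ↦ (cotensorπ G' E s.unop y).op)
    (ConcreteCategory.congr_hom (congr_app h s) x)

lemma tensor_map_app_comp_tensorToOpCotensor (e : C ≅ G) {E B : M} (p : E ⟶ B) :
    ((tensorFunctor Rᵒᵖ Mᵒᵖ).map p.op).app C ≫ tensorToOpCotensor e E =
      tensorToOpCotensor e B ≫
        (Functor.opHom R M).map (((cotensorFunctor R M).obj (op G)).map p).op := by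
  ext s
  refine tensor_obj_hom_ext fun x ↦ ?_
  rw [NatTrans.comp_app, NatTrans.comp_app, ← Category.assoc, ← Category.assoc, tensorι_map_app',
    Category.assoc, tensorι_tensorToOpCotensor, tensorι_tensorToOpCotensor]
  exact (congrArg Quiver.Hom.op (cotensor_map_app_π' G p s.unop (e.hom.app s x))).symm

end

/-- An isomorphism between the maps from the pushouts induced by isomorphic commutative squares. -/
lemma nonempty_arrow_iso_of_isPushout {D : Type*} [Category* D] {a b c d t a' b' c' d' t' : D}
    {f : a ⟶ b} {g : a ⟶ c} {h : b ⟶ d} {k : c ⟶ d} (sq : IsPushout f g h k)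
    {f' : a' ⟶ b'} {g' : a' ⟶ c'} {h' : b' ⟶ d'} {k' : c' ⟶ d'} (sq' : IsPushout f' g' h' k')
    (π : d ⟶ t) (π' : d' ⟶ t') (ea : a ⟶ a') (eb : b ⟶ b') (ec : c ⟶ c') (et : t ⟶ t')
    [IsIso ea] [IsIso eb] [IsIso ec] [IsIso et]
    (hf : f ≫ eb = ea ≫ f') (hg : g ≫ ec = ea ≫ g')
    (hh : h ≫ π ≫ et = eb ≫ h' ≫ π') (hk : k ≫ π ≫ et = ec ≫ k' ≫ π') :
    Nonempty (Arrow.mk π ≅ Arrow.mk π') := by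
  have sq₁ : IsPushout f g (eb ≫ h') (ec ≫ k') :=
    sq'.of_iso (asIso ea).symm (asIso eb).symm (asIso ec).symm (Iso.refl _)
      (by simp [← reassoc_of% hf]) (by simp [← reassoc_of% hg]) (by simp) (by simp)
  refine ⟨Arrow.isoMk (sq.isoIsPushout _ _ sq₁) (asIso et) ?_⟩
  apply sq.hom_ext
  · simp [hh]
  · simp [hk]

lemma llp_isoClosure {D : Type*} [Category* D] (W : MorphismProperty D) :
    W.isoClosure.llp = W.llp := by
  refine le_antisymm (fun _ _ _ hi _ _ p hp ↦ hi _ (W.le_isoClosure _ hp)) ?_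
  rintro _ _ i hi _ _ p ⟨_, _, q, hq, ⟨e⟩⟩
  have := hi q hq
  exact HasLiftingProperty.of_arrow_iso_right i e

namespace ReedyStructure

variable {R : Type v} [SmallCategory R] {Rm Rp : MorphismProperty R}
  [Rm.IsMultiplicative] [Rp.IsMultiplicative] (ρ : ReedyStructure Rm Rp ℕ)
  {M : Type u} [Category.{v} M]

/-- The boundary `∂R(-, r)` identifies to the coboundary for the opposite Reedy structure. -/
def coboundaryOpIso (r : R) :
    (ρ.op.coboundary (op r)).toFunctor ≅ (ρ.boundary r).toFunctor :=
  NatIso.ofComponents fun s ↦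
    { hom := ↾fun f ↦ ⟨f.1.unop, by
        obtain ⟨t, a, b, ht, h⟩ := f.2
        exact ⟨t.unop, b.unop, a.unop, ht, by rw [← unop_comp, h]⟩⟩
      inv := ↾fun f ↦ ⟨f.1.op, by
        obtain ⟨t, a, b, ht, h⟩ := f.2
        exact ⟨op t, b.op, a.op, ht, by rw [← op_comp, h]⟩⟩ }

variable [HasLimits M]

/-- Passing to opposites turns the pullback defining the pullback-cotensor into a pushout.
`tensorToOpCotensor` identifies the corners and targets, compatibly with both maps of the square.
The isomorphisms e and e' account for the boundaries and representables of Rᵒᵖ not being literally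
those of R. -/
lemma nonempty_arrow_iso_pushoutTensor {E B : M} (p : E ⟶ B) (r : R) :
    Nonempty (Arrow.mk (ρ.op.pushoutTensor p.op (op r)) ≅
      Arrow.mk ((Functor.opHom R M).map (ρ.pullbackCotensor p r).op)) := by
  let sq := Functor.PushoutObjObj.ofHasPushout (tensorFunctor Rᵒᵖ Mᵒᵖ) p.op
    (ρ.op.coboundary (op r)).ι
  let sq' := Functor.PullbackObjObj.ofHasPullback (cotensorFunctor R M) (ρ.boundary r).ι p
  have : (Functor.opHom R M).IsEquivalence :=
    (Functor.opUnopEquiv R M).isEquivalence_functor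
  have po := (sq'.isPullback.op.flip).map (Functor.opHom R M)
  let e := ρ.coboundaryOpIso r
  let e' := Coyoneda.objOpOp r
  have he : (ρ.op.coboundary (op r)).ι ≫ e'.hom = e.hom ≫ (ρ.boundary r).ι := rfl
  exact nonempty_arrow_iso_of_isPushout sq.isPushout po sq.ι
    ((Functor.opHom R M).map sq'.π.op) (tensorToOpCotensor e B) (tensorToOpCotensor e E)
    (tensorToOpCotensor e' B) (tensorToOpCotensor e' E)
    (tensor_map_app_comp_tensorToOpCotensor e p)
    (tensor_map_comp_tensorToOpCotensor e e' _ _ he B)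
    (by
      rw [sq.inl_ι_assoc, tensor_map_comp_tensorToOpCotensor e e' _ _ he E, ← Functor.map_comp,
        ← op_comp, sq'.π_fst])
    (by
      rw [sq.inr_ι_assoc, tensor_map_app_comp_tensorToOpCotensor e' p, ← Functor.map_comp,
        ← op_comp, sq'.π_snd])

-- Equality of arrows allows elimination when the source and target of τ are not variables, as for
-- the opposite of a given map.
omit [HasLimits M] in
lemma exists_arrow_eq_of_pushoutTensorClass [HasColimits M] {I : MorphismProperty M}
    {Φ Ψ : R ⥤ M} {τ : Φ ⟶ Ψ} (hτ : ρ.pushoutTensorClass I τ) :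
    ∃ (A B : M) (i : A ⟶ B) (_ : I i) (r : R), Arrow.mk τ = Arrow.mk (ρ.pushoutTensor i r) := by
  obtain ⟨i, hi, r⟩ := hτ
  exact ⟨_, _, i, hi, r, rfl⟩

-- Passage to opposites is a contravariant equivalence, so isomorphisms of arrows descend along it,
-- with source and target exchanged.
omit [HasLimits M] in
lemma nonempty_arrow_iso_of_opHom {Φ Ψ Φ' Ψ' : R ⥤ M} {τ : Φ ⟶ Ψ} {τ' : Φ' ⟶ Ψ'}
    (h : Nonempty (Arrow.mk ((Functor.opHom R M).map τ.op) ≅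
      Arrow.mk ((Functor.opHom R M).map τ'.op))) :
    Nonempty (Arrow.mk τ ≅ Arrow.mk τ') := by
  obtain ⟨e⟩ := h
  have ff : (Functor.opHom R M).FullyFaithful := (Functor.opUnopEquiv R M).fullyFaithfulFunctor
  refine ⟨(Arrow.isoMk (ff.preimageIso (Arrow.rightFunc.mapIso e)).unop
    (ff.preimageIso (Arrow.leftFunc.mapIso e)).unop ?_).symm⟩
  apply Quiver.Hom.op_inj
  apply ff.map_injective
  simp only [Arrow.mk_hom, op_comp, Functor.map_comp, Iso.unop_hom, Quiver.Hom.op_unop]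
  exact (congrArg (_ ≫ ·) (ff.map_preimage e.hom.right)).trans
    (e.hom.w.symm.trans (congrArg (· ≫ _) (ff.map_preimage e.hom.left)).symm)

lemma isoClosure_pullbackCotensorClass (I : MorphismProperty M) :
    (ρ.pullbackCotensorClass I).isoClosure = (ρ.opPushoutTensorClass I).isoClosure := by
  apply le_antisymm
  · rw [MorphismProperty.isoClosure_le_iff]
    rintro _ _ _ ⟨p, hp, r⟩
    -- This is the map of `R ⥤ M` whose opposite is the given pushout-product on the nose, so it
    -- belongs to the class by definition.
    let τ := ((Functor.opInv R M).map (ρ.op.pushoutTensor p.op (op r))).unop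
    have hτ : ρ.opPushoutTensorClass I τ := pushoutTensorClass.mk p.op hp (op r)
    obtain ⟨e⟩ := nonempty_arrow_iso_of_opHom (τ := τ) (ρ.nonempty_arrow_iso_pushoutTensor p r)
    exact ⟨_, _, τ, hτ, ⟨e⟩⟩
  · rw [MorphismProperty.isoClosure_le_iff]
    intro Φ Ψ τ hτ
    obtain ⟨_, _, i, hi, r, e⟩ := ρ.op.exists_arrow_eq_of_pushoutTensorClass hτ
    obtain ⟨e'⟩ := ρ.nonempty_arrow_iso_pushoutTensor i.unop r.unop
    obtain ⟨e''⟩ := nonempty_arrow_iso_of_opHom ⟨eqToIso e ≪≫ e'⟩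
    exact ⟨_, _, _, .mk i.unop hi r.unop, ⟨e''.symm⟩⟩

lemma llp_opPushoutTensorClass (I : MorphismProperty M) :
    (ρ.opPushoutTensorClass I).llp = (ρ.pullbackCotensorClass I).llp := by
  rw [← llp_isoClosure, ← isoClosure_pullbackCotensorClass, llp_isoClosure]

end ReedyStructure

end HomotopicalAlgebra

theorem theorem5p6
    {M : Type u} [Category.{v} M] [HasLimits M] [HasColimits M] [ModelCategory M]
    {R : Type v} [SmallCategory R] {Rm Rp : MorphismProperty R}
    [Rm.IsMultiplicative] [Rp.IsMultiplicative] (ρ : ReedyStructure Rm Rp ℕ)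
    (X Z : MorphismProperty M) (hXZ : IsFibrantlyGeneratedBy M X Z) :
    ∃ _ : ModelCategory (R ⥤ M),
      ρ.IsReedyModelStructure (M := M) ∧
      IsFibrantlyGeneratedBy (R ⥤ M)
        (ρ.opPushoutTensorClass X) (ρ.opPushoutTensorClass Z) ∧
      IsFibrantlyGeneratedBy (R ⥤ M)
        (ρ.pullbackCotensorClass X) (ρ.pullbackCotensorClass Z) ∧
      (ρ.pullbackCotensorClass X).isoClosure = (ρ.opPushoutTensorClass X).isoClosure ∧
      (ρ.pullbackCotensorClass Z).isoClosure = (ρ.opPushoutTensorClass Z).isoClosure :=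
  ⟨ρ.reedyModelCategory, ρ.isReedyModelStructure_reedyModelCategory,
    ρ.isFibrantlyGeneratedBy_reedyModelCategory hXZ (ρ.llp_opPushoutTensorClass X)
      (ρ.llp_opPushoutTensorClass Z),
    ρ.isFibrantlyGeneratedBy_reedyModelCategory hXZ rfl rfl,
    ρ.isoClosure_pullbackCotensorClass X, ρ.isoClosure_pullbackCotensorClass Z⟩
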